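/- All Hilbert spaces are complex. For an ordinal $n$, an $n$-isometry on a Hilbert space is a family $(V_k)_{0\le k<n}$ of commuting isometric operators on that space. A reducing subspace of a family of commuting isometries is a closed subspace $\mathfrak M$ such that $\mathfrak M$ and $\mathfrak M^\perp$ are invariant for every operator of the family. For a subset $J$ of the index set, the family is $J$-pure if the only reducing subspace to which every operator with index in $J$ restricts as a unitary operator is $\{0\}$. It is completely nonunitary if it is $J$-pure with $J$ the whole index set. Let $\mathbb V=(V_k)_{0\le k<n}$ be an $n$-isometry on $\mathfrak H$ and let $A$ be a contraction ($\|A\|\le 1$) on $\mathfrak H$ commuting with every $V_k$. Let $\widetilde{\mathbb V}=(\widetilde V_k)_{0\le k<n}$ on $\widetilde{\mathfrak H}\supset\mathfrak H$ be the minimal unitary extension of $\mathbb V$, that is, the (essentially unique) family of commuting unitary operators extending $\mathbb V$ such that the vectors $\widetilde V_{k_1}^*\cdots\widetilde V_{k_N}^*h$ ($N\ge 0$, $0\le k_i<n$, $h\in\mathfrak H$) span a dense subspace of $\widetilde{\mathfrak H}$. Let $\widetilde A$ be the unique bounded operator on $\widetilde{\mathfrak H}$ that extends $A$ and commutes with every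 $\widetilde V_k$; it is a contraction. Put $D_{\widetilde A}=(I-\widetilde A^*\widetilde A)^{1/2}$ and $\mathfrak D=\overline{D_{\widetilde A}\widetilde{\mathfrak H}}$, which reduces $\widetilde{\mathbb V}$. The model $\mathbb W_A=(W_k)_{0\le k\le n}$ is the $(n+1)$-isometry on $\mathfrak H\oplus\mathfrak D\oplus\mathfrak D\oplus\cdots$ given by $$W_k(h\oplus d_0\oplus d_1\oplus\cdots)=V_kh\oplus\widetilde V_kd_0\oplus\widetilde V_kd_1\oplus\cdots\quad(0\le k<n),$$ $$W_n(h\oplus d_0\oplus d_1\oplus\cdots)=Ah\oplus D_{\widetilde A}h\oplus d_0\oplus d_1\oplus\cdots.$$ **Theorem.** Let $n\ge 1$ be an ordinal and let $\mathbb W=(W_k)_{0\le k\le n}$ be an $(n+1)$-isometry on a Hilbert space $\mathfrak K$. The following conditions are equivalent. 1. $\mathbb W$ is $\{0\le k<n\}$-pure. 2. There exist a completely nonunitary $n$-isometry $\mathbb V$ on a Hilbert space $\mathfrak H$ and a contraction $A$ on $\mathfrak H$ commuting with every operator of $\mathbb V$ such that $\mathbb W$ is unitarily equivalent to $\mathbb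 W_A$. -/

import Mathlib

universe u v w

noncomputable section

open scoped InnerProductSpace ENNReal

/-! ### Commuting isometries, reducing subspaces, pureness -/

/-- A bounded operator on a Hilbert space is unitary if it is isometric and onto. -/
def IsUnitaryOp {H : Type v} [NormedAddCommGroup H] [InnerProductSpace ℂ H]
    (T : H →L[ℂ] H) : Prop :=
  (∀ x, ‖T x‖ = ‖x‖) ∧ Function.Surjective T

/-- A family, indexed by `ι`, of commuting isometric operators on the space `H`. -/
structure CommutingIsometries (ι : Type u) (H : Type v) [NormedAddCommGroup H]
    [InnerProductSpace ℂ H] where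
  /-- the operators of the family -/
  op : ι → H →L[ℂ] H
  norm_op : ∀ i x, ‖op i x‖ = ‖x‖
  comm : ∀ i j, op i ∘L op j = op j ∘L op i

/-- For an ordinal `n`, an `n`-isometry is a family `(V_k)_{0 ≤ k < n}` of commuting isometries. -/
abbrev NIsometry (n : Ordinal.{u}) (H : Type v) [NormedAddCommGroup H]
    [InnerProductSpace ℂ H] : Type _ :=
  CommutingIsometries (Set.Iio n) H

namespace CommutingIsometries

section Basic

variable {ι : Type u} {H : Type v} [NormedAddCommGroup H] [InnerProductSpace ℂ H]

/-- The subspace `M` is invariant for the family `V`. -/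
def IsInvariant (V : CommutingIsometries ι H) (M : Submodule ℂ H) : Prop :=
  ∀ i, Set.MapsTo (V.op i) M M

/-- The closed subspace `M` is reducing for `V`: both `M` and its orthogonal complement are
invariant for `V`. -/
structure IsReducing (V : CommutingIsometries ι H) (M : Submodule ℂ H) : Prop where
  isClosed : IsClosed (M : Set H)
  invariant : V.IsInvariant M
  invariant_orthogonal : V.IsInvariant Mᗮ

/-- The restriction `V | M` of the family `V` to an invariant subspace `M`. -/
def restrict (V : CommutingIsometries ι H) (M : Submodule ℂ H) (hM : V.IsInvariant M) :
    CommutingIsometries ι M where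
  op i := (V.op i).restrict (hM i)
  norm_op i x := V.norm_op i x
  comm i j := by
    ext x
    exact DFunLike.congr_fun (V.comm i j) (x : H)

/-- The family `V` is `J`-unitary if `V_j` is unitary for every `j ∈ J`. -/
def IsUnitaryOn (V : CommutingIsometries ι H) (J : Set ι) : Prop :=
  ∀ j ∈ J, IsUnitaryOp (V.op j)

/-- The family `V` is `J`-pure if it has no `J`-unitary direct summand acting on a nonzero
space. -/
def IsPure (V : CommutingIsometries ι H) (J : Set ι) : Prop :=
  ∀ (M : Submodule ℂ H) (hM : V.IsReducing M),
    (V.restrict M hM.invariant).IsUnitaryOn J → M = ⊥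

/-- The family `V` is completely nonunitary if it has no unitary direct summand acting on a
nonzero space. -/
def IsCompletelyNonunitary (V : CommutingIsometries ι H) : Prop :=
  V.IsPure Set.univ

/-- The operator `A` belongs to the commutant of the family `V`. -/
def InCommutant (V : CommutingIsometries ι H) (A : H →L[ℂ] H) : Prop :=
  ∀ i, A ∘L V.op i = V.op i ∘L A

/-- Unitary equivalence of two families with the same index set. -/
def UnitarilyEquivalent {K : Type w} [NormedAddCommGroup K] [InnerProductSpace ℂ K]
    (V : CommutingIsometries ι H) (W : CommutingIsometries ι K) : Prop :=
  ∃ Φ : H ≃ₗᵢ[ℂ] K, ∀ i x, Φ (V.op i x) = W.op i (Φ x)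

end Basic

section Extension

variable {ι : Type u} {H : Type v} [NormedAddCommGroup H] [InnerProductSpace ℂ H]

/-- A minimal unitary extension of the family `V` on `H`: a family `U` of commuting unitary
operators on a Hilbert space containing `H` (through the isometric embedding `emb`), which extends
`V`, and such that the vectors `U_{k_1}^* ⋯ U_{k_N}^* h`, with `N ≥ 0` and `h ∈ H`, span a dense
subspace. -/
structure MinimalUnitaryExtension (V : CommutingIsometries ι H) where
  /-- the larger Hilbert space -/
  space : Type v
  [normedAddCommGroup : NormedAddCommGroup space]
  [innerProductSpace : InnerProductSpace ℂ space]
  [completeSpace : CompleteSpace space]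
  /-- the commuting unitary operators -/
  family : CommutingIsometries ι space
  unitary : ∀ i, IsUnitaryOp (family.op i)
  /-- the inclusion of the original space -/
  emb : H →ₗᵢ[ℂ] space
  extends_op : ∀ i h, family.op i (emb h) = emb (V.op i h)
  minimal : (Submodule.span ℂ {x : space | ∃ (l : List ι) (h : H),
    x = (l.map fun k => ContinuousLinearMap.adjoint (family.op k)).prod (emb h)}).topologicalClosure
      = ⊤

attribute [instance] MinimalUnitaryExtension.normedAddCommGroup
  MinimalUnitaryExtension.innerProductSpace MinimalUnitaryExtension.completeSpace

end Extension

section Existence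

variable {ι : Type u}

theorem adjoint_apply_self_of_norm {E : Type w} [NormedAddCommGroup E] [InnerProductSpace ℂ E]
    [CompleteSpace E] {s : E →L[ℂ] E} (hs : ∀ x, ‖s x‖ = ‖x‖) (x : E) :
    ContinuousLinearMap.adjoint s (s x) = x :=
  DFunLike.congr_fun ((ContinuousLinearMap.norm_map_iff_adjoint_comp_self s).1 hs) x

theorem norm_adjoint_apply_le {E : Type w} [NormedAddCommGroup E] [InnerProductSpace ℂ E]
    [CompleteSpace E] {s : E →L[ℂ] E} (hs : ∀ x, ‖s x‖ = ‖x‖) (x : E) :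
    ‖ContinuousLinearMap.adjoint s x‖ ≤ ‖x‖ := by
  have h1 : ‖ContinuousLinearMap.adjoint s‖ ≤ 1 := by
    rw [LinearIsometryEquiv.norm_map]
    exact s.opNorm_le_bound zero_le_one fun x => by rw [hs, one_mul]
  exact (ContinuousLinearMap.le_of_opNorm_le _ h1 x).trans (one_mul _).le

theorem adjoint_prod_foldr {E : Type w} [NormedAddCommGroup E] [InnerProductSpace ℂ E]
    [CompleteSpace E] (U : CommutingIsometries ι E) (l : List ι) (x : E) :
    ((l.reverse.map fun k => ContinuousLinearMap.adjoint (U.op k)).prod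
      (l.foldr (fun k y => U.op k y) x)) = x := by
  induction l with
  | nil => rfl
  | cons k l ih =>
    rw [List.reverse_cons, List.map_append, List.prod_append, List.map_cons, List.prod_cons,
      mul_apply_eq_comp, mul_apply_eq_comp, List.map_nil, List.prod_nil, one_apply_eq_self,
      List.foldr_cons, adjoint_apply_self_of_norm (U.norm_op k), ih]

theorem norm_prod_adjoint_le {E : Type w} [NormedAddCommGroup E] [InnerProductSpace ℂ E]
    [CompleteSpace E] (U : CommutingIsometries ι E) (l : List ι) (x : E) :
    ‖(l.map fun k => ContinuousLinearMap.adjoint (U.op k)).prod x‖ ≤ ‖x‖ := by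
  induction l with
  | nil => rfl
  | cons k l ih =>
    rw [List.map_cons, List.prod_cons, mul_apply_eq_comp]
    exact (norm_adjoint_apply_le (U.norm_op k) _).trans ih

/-- A criterion for the minimality of a unitary extension. -/
theorem minimal_of_forall {A : Type v} {E : Type w} [NormedAddCommGroup E] [InnerProductSpace ℂ E]
    [CompleteSpace E] (U : CommutingIsometries ι E) (emb : A → E)
    (hU : ∀ (x : E) (ε : ℝ), 0 < ε → ∃ (l : List ι) (h : A),
      ‖l.foldr (fun k y => U.op k y) x - emb h‖ < ε) :
    (Submodule.span ℂ {x : E | ∃ (l : List ι) (h : A),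
      x = (l.map fun k => ContinuousLinearMap.adjoint (U.op k)).prod (emb h)}).topologicalClosure
        = ⊤ := by
  rw [← Submodule.dense_iff_topologicalClosure_eq_top]
  intro x
  rw [Metric.mem_closure_iff]
  intro ε hε
  obtain ⟨l, h, hlt⟩ := hU x ε hε
  refine ⟨_, Submodule.subset_span ⟨l.reverse, h, rfl⟩, ?_⟩
  rw [dist_eq_norm]
  refine lt_of_le_of_lt ?_ hlt
  conv_lhs => enter [1, 1]; rw [← adjoint_prod_foldr U l x]
  rw [← map_sub]
  exact norm_prod_adjoint_le _ _ _

theorem parallelogram_of_le {E : Type w} [NormedAddCommGroup E] [NormedSpace ℂ E]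
    (h : ∀ f g : E, ‖f + g‖ * ‖f + g‖ + ‖f - g‖ * ‖f - g‖ ≤ 2 * (‖f‖ * ‖f‖ + ‖g‖ * ‖g‖))
    (f g : E) : ‖f + g‖ * ‖f + g‖ + ‖f - g‖ * ‖f - g‖ = 2 * (‖f‖ * ‖f‖ + ‖g‖ * ‖g‖) := by
  refine le_antisymm (h f g) ?_
  have h := h (f + g) (f - g)
  have e1 : f + g + (f - g) = (2 : ℂ) • f := by module
  have e2 : f + g - (f - g) = (2 : ℂ) • g := by module
  have e3 : ‖(2 : ℂ)‖ = 2 := by simp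
  rw [e1, e2, norm_smul, norm_smul, e3] at h
  linarith


variable {H : Type v} [NormedAddCommGroup H] [InnerProductSpace ℂ H]

/-- The monoid of operators generated by the family. -/
def monoid (V : CommutingIsometries ι H) : Submonoid (H →L[ℂ] H) :=
  Submonoid.closure (Set.range V.op)

theorem op_mem_monoid (V : CommutingIsometries ι H) (i : ι) : V.op i ∈ V.monoid :=
  Submonoid.subset_closure ⟨i, rfl⟩

theorem monoid_comm (V : CommutingIsometries ι H) {s t : H →L[ℂ] H} (hs : s ∈ V.monoid)
    (ht : t ∈ V.monoid) : s * t = t * s := by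
  have h1 : V.monoid ≤ Submonoid.centralizer (Set.range V.op) := by
    refine Submonoid.closure_le.2 ?_
    rintro _ ⟨i, rfl⟩
    rw [SetLike.mem_coe, Submonoid.mem_centralizer_iff]
    rintro _ ⟨j, rfl⟩
    exact V.comm j i
  have h2 : V.monoid ≤ Submonoid.centralizer (V.monoid : Set (H →L[ℂ] H)) := by
    refine Submonoid.closure_le.2 ?_
    rintro _ ⟨i, rfl⟩
    rw [SetLike.mem_coe, Submonoid.mem_centralizer_iff]
    intro g hg
    exact ((Submonoid.mem_centralizer_iff.1 (h1 hg)) _ ⟨i, rfl⟩).symm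
  exact (Submonoid.mem_centralizer_iff.1 (h2 ht)) _ hs

theorem monoid_norm (V : CommutingIsometries ι H) {s : H →L[ℂ] H} (hs : s ∈ V.monoid) :
    ∀ x, ‖s x‖ = ‖x‖ := by
  induction hs using Submonoid.closure_induction with
  | mem s hs => obtain ⟨i, rfl⟩ := hs; exact V.norm_op i
  | one => intro x; rfl
  | mul s t _ _ h1 h2 => intro x; rw [mul_apply_eq_comp, h1, h2]

theorem exists_list_of_mem_monoid (V : CommutingIsometries ι H) {s : H →L[ℂ] H}
    (hs : s ∈ V.monoid) : ∃ l : List ι, s = (l.map V.op).prod := by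
  induction hs using Submonoid.closure_induction with
  | mem s hs => obtain ⟨i, rfl⟩ := hs; exact ⟨[i], by simp⟩
  | one => exact ⟨[], rfl⟩
  | mul s t _ _ h1 h2 =>
    obtain ⟨l, rfl⟩ := h1
    obtain ⟨m, rfl⟩ := h2
    exact ⟨l ++ m, by simp⟩


variable [CompleteSpace H]

/-- Bounded families `(f s)`, indexed by the monoid `S` generated by the `V_k`, with
`t^* f (s t) = f s`. This is a concrete model of the space of the minimal unitary extension. -/
def coherent (V : CommutingIsometries ι H) : Submodule ℂ (lp (fun _ : V.monoid => H) ∞) where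
  carrier := {f | ∀ s t : V.monoid, ContinuousLinearMap.adjoint t.1 (f (s * t)) = f s}
  add_mem' {f g} hf hg s t := by
    simp only [lp.coeFn_add, Pi.add_apply, map_add, hf s t, hg s t]
  zero_mem' s t := by simp
  smul_mem' c f hf s t := by
    have h := hf s t
    simp only [lp.coeFn_smul, Pi.smul_apply, map_smul, h]

theorem coherent_isClosed (V : CommutingIsometries ι H) :
    IsClosed (V.coherent : Set (lp (fun _ : V.monoid => H) ∞)) := by
  have he : ∀ s : V.monoid, Continuous fun f : lp (fun _ : V.monoid => H) ∞ => f s := fun s =>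
    (lp.lipschitzWith_one_eval (E := fun _ : V.monoid => H) ∞ s).continuous
  have : (V.coherent : Set (lp (fun _ : V.monoid => H) ∞)) =
      ⋂ s : V.monoid, ⋂ t : V.monoid,
        {f | ContinuousLinearMap.adjoint t.1 (f (s * t)) = f s} := by
    ext f; simp [coherent]
  rw [this]
  exact isClosed_iInter fun s => isClosed_iInter fun t =>
    isClosed_eq ((ContinuousLinearMap.adjoint t.1).continuous.comp (he _)) (he _)

theorem coherent_norm_mono (V : CommutingIsometries ι H) (f : V.coherent) (s t : V.monoid) :
    ‖f.1 s‖ ≤ ‖f.1 (s * t)‖ := by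
  rw [← f.2 s t]
  exact norm_adjoint_apply_le (V.monoid_norm t.2) _

theorem coherent_norm_mono' (V : CommutingIsometries ι H) (f : V.coherent) (s t : V.monoid) :
    ‖f.1 s‖ ≤ ‖f.1 (t * s)‖ := by
  have : t * s = s * t := Subtype.ext (V.monoid_comm t.2 s.2)
  rw [this]
  exact V.coherent_norm_mono f s t

theorem coherent_apply_le (V : CommutingIsometries ι H) (f : V.coherent) (s : V.monoid) :
    ‖f.1 s‖ ≤ ‖f‖ :=
  lp.norm_apply_le_norm ENNReal.top_ne_zero f.1 s

theorem coherent_sq_le (V : CommutingIsometries ι H) (f : V.coherent) {C : ℝ}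
    (h : ∀ s, ‖f.1 s‖ * ‖f.1 s‖ ≤ C) : ‖f‖ * ‖f‖ ≤ C := by
  have hC : 0 ≤ C := (mul_self_nonneg _).trans (h 1)
  have : ‖f.1‖ ≤ √C := lp.norm_le_of_forall_le (Real.sqrt_nonneg _) fun s =>
    Real.le_sqrt_of_sq_le (by rw [sq]; exact h s)
  calc ‖f‖ * ‖f‖ ≤ √C * √C := mul_self_le_mul_self (norm_nonneg _) this
    _ = C := Real.mul_self_sqrt hC

theorem coherent_parallelogram_le (V : CommutingIsometries ι H) (f g : V.coherent) :
    ‖f + g‖ * ‖f + g‖ + ‖f - g‖ * ‖f - g‖ ≤ 2 * (‖f‖ * ‖f‖ + ‖g‖ * ‖g‖) := by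
  rw [← le_sub_iff_add_le]
  refine V.coherent_sq_le _ fun s => ?_
  rw [le_sub_comm]
  refine V.coherent_sq_le _ fun t => ?_
  rw [le_sub_iff_add_le, add_comm]
  have h1 := mul_self_le_mul_self (norm_nonneg _) (V.coherent_norm_mono (f + g) s t)
  have h2 := mul_self_le_mul_self (norm_nonneg _) (V.coherent_norm_mono' (f - g) t s)
  have h3 := parallelogram_law_with_norm ℂ (f.1 (s * t)) (g.1 (s * t))
  have h4 := mul_self_le_mul_self (norm_nonneg _) (V.coherent_apply_le f (s * t))
  have h5 := mul_self_le_mul_self (norm_nonneg _) (V.coherent_apply_le g (s * t))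
  have e1 : (f + g).1 (s * t) = f.1 (s * t) + g.1 (s * t) := rfl
  have e2 : (f - g).1 (s * t) = f.1 (s * t) - g.1 (s * t) := rfl
  rw [e1] at h1
  rw [e2] at h2
  linarith

instance coherentInnerProductSpace (V : CommutingIsometries ι H) :
    InnerProductSpace ℂ V.coherent :=
  InnerProductSpace.ofNorm ℂ (parallelogram_of_le V.coherent_parallelogram_le)

instance coherentCompleteSpace (V : CommutingIsometries ι H) : CompleteSpace V.coherent :=
  V.coherent_isClosed.completeSpace_coe

/-- A bounded family, as a coherent family. -/
def coherentMk (V : CommutingIsometries ι H) (f : V.monoid → H) (C : ℝ) (hC : ∀ s, ‖f s‖ ≤ C)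
    (hf : ∀ s t : V.monoid, ContinuousLinearMap.adjoint t.1 (f (s * t)) = f s) : V.coherent :=
  ⟨⟨f, memℓp_infty ⟨C, by rintro _ ⟨s, rfl⟩; exact hC s⟩⟩, hf⟩

theorem coherentMk_le (V : CommutingIsometries ι H) (f : V.monoid → H) (C : ℝ)
    (hC : ∀ s, ‖f s‖ ≤ C)
    (hf : ∀ s t : V.monoid, ContinuousLinearMap.adjoint t.1 (f (s * t)) = f s) (s : V.monoid) :
    ‖f s‖ ≤ ‖V.coherentMk f C hC hf‖ :=
  V.coherent_apply_le (V.coherentMk f C hC hf) s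

/-- The translation `(U_i f) s = f (V_i s)` on coherent families. -/
def coherentShift (V : CommutingIsometries ι H) (i : ι) (f : V.coherent) : V.coherent :=
  V.coherentMk (fun s => f.1 (⟨V.op i, V.op_mem_monoid i⟩ * s)) ‖f‖
    (fun _ => V.coherent_apply_le f _) (fun s t => by rw [← mul_assoc]; exact f.2 _ t)

theorem norm_coherentShift (V : CommutingIsometries ι H) (i : ι) (f : V.coherent) :
    ‖V.coherentShift i f‖ = ‖f‖ := by
  refine le_antisymm ?_ ?_
  · exact lp.norm_le_of_forall_le (norm_nonneg _) fun s => V.coherent_apply_le f _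
  · refine lp.norm_le_of_forall_le (norm_nonneg _) fun s => ?_
    exact (V.coherent_norm_mono' f s ⟨V.op i, V.op_mem_monoid i⟩).trans
      (V.coherent_apply_le (V.coherentShift i f) s)

/-- The translation, as a linear isometry. -/
def coherentOp (V : CommutingIsometries ι H) (i : ι) : V.coherent →ₗᵢ[ℂ] V.coherent where
  toFun f := V.coherentShift i f
  map_add' _ _ := rfl
  map_smul' _ _ := rfl
  norm_map' f := V.norm_coherentShift i f

theorem coherentOp_apply (V : CommutingIsometries ι H) (i : ι) (f : V.coherent) (s : V.monoid) :
    (V.coherentOp i f).1 s = f.1 (⟨V.op i, V.op_mem_monoid i⟩ * s) := rfl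

/-- The coherent family `(s h)_s`. -/
def coherentIncl (V : CommutingIsometries ι H) (h : H) : V.coherent :=
  V.coherentMk (fun s => s.1 h) ‖h‖ (fun s => (V.monoid_norm s.2 h).le) (fun s t => by
    have : (s * t).1 h = t.1 (s.1 h) := by
      rw [Submonoid.coe_mul, V.monoid_comm s.2 t.2]; rfl
    rw [this, adjoint_apply_self_of_norm (V.monoid_norm t.2)])

/-- The inclusion of `H` in the space of coherent families, `h ↦ (s h)_s`. -/
def coherentEmb (V : CommutingIsometries ι H) : H →ₗᵢ[ℂ] V.coherent where
  toFun h := V.coherentIncl h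
  map_add' f g := by
    apply Subtype.ext; apply lp.ext; funext s; exact map_add s.1 f g
  map_smul' c f := by
    apply Subtype.ext; apply lp.ext; funext s; exact map_smul s.1 c f
  norm_map' h := by
    refine le_antisymm ?_ ?_
    · exact lp.norm_le_of_forall_le (norm_nonneg _) fun s => (V.monoid_norm s.2 h).le
    · exact V.coherent_apply_le (V.coherentIncl h) 1

/-- The translations, as a family of commuting isometries. -/
def coherentFamily (V : CommutingIsometries ι H) : CommutingIsometries ι V.coherent where
  op i := (V.coherentOp i).toContinuousLinearMap
  norm_op i f := (V.coherentOp i).norm_map f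
  comm i j := by
    refine ContinuousLinearMap.ext fun f => ?_
    apply Subtype.ext; apply lp.ext; funext s
    change f.1 (_ * (_ * s)) = f.1 (_ * (_ * s))
    have e : (⟨V.op j, V.op_mem_monoid j⟩ * ⟨V.op i, V.op_mem_monoid i⟩ : V.monoid) =
        ⟨V.op i, V.op_mem_monoid i⟩ * ⟨V.op j, V.op_mem_monoid j⟩ := Subtype.ext (V.comm j i)
    rw [← mul_assoc, ← mul_assoc, e]

theorem coherentFamily_apply (V : CommutingIsometries ι H) (i : ι) (f : V.coherent)
    (s : V.monoid) :
    (V.coherentFamily.op i f).1 s = f.1 (⟨V.op i, V.op_mem_monoid i⟩ * s) := rfl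

theorem coherentFamily_unitary (V : CommutingIsometries ι H) (i : ι) :
    IsUnitaryOp (V.coherentFamily.op i) := by
  refine ⟨V.coherentFamily.norm_op i, fun f => ?_⟩
  refine ⟨V.coherentMk (fun s => ContinuousLinearMap.adjoint (V.op i) (f.1 s)) ‖f‖
    (fun s => (norm_adjoint_apply_le (V.norm_op i) _).trans (V.coherent_apply_le f s))
    (fun s t => ?_), ?_⟩
  · rw [← f.2 s t, ← ContinuousLinearMap.comp_apply, ← ContinuousLinearMap.comp_apply,
      ← ContinuousLinearMap.adjoint_comp, ← ContinuousLinearMap.adjoint_comp]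
    congr 2
    exact V.monoid_comm (V.op_mem_monoid i) t.2
  · apply Subtype.ext; apply lp.ext; funext s
    change ContinuousLinearMap.adjoint (V.op i) (f.1 (_ * s)) = f.1 s
    have e : (⟨V.op i, V.op_mem_monoid i⟩ : V.monoid) * s = s * ⟨V.op i, V.op_mem_monoid i⟩ :=
      Subtype.ext (V.monoid_comm (V.op_mem_monoid i) s.2)
    rw [← f.2 s ⟨V.op i, V.op_mem_monoid i⟩, e]

theorem coherentFamily_foldr_apply (V : CommutingIsometries ι H) (l : List ι) :
    ∀ (f : V.coherent) (s t : V.monoid), t.1 = (l.map V.op).prod →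
      (l.foldr (fun k g => V.coherentFamily.op k g) f).1 s = f.1 (s * t) := by
  induction l with
  | nil =>
    intro f s t ht
    have e : t = 1 := Subtype.ext ht
    rw [e, mul_one s]; rfl
  | cons k l ih =>
    intro f s t ht
    have hl : (l.map V.op).prod ∈ V.monoid :=
      Submonoid.list_prod_mem _ fun x hx => by
        obtain ⟨i, -, rfl⟩ := List.mem_map.1 hx
        exact V.op_mem_monoid i
    have h := ih f (⟨V.op k, V.op_mem_monoid k⟩ * s) ⟨_, hl⟩ rfl
    rw [List.foldr_cons, coherentFamily_apply, h]
    suffices e : ⟨V.op k, V.op_mem_monoid k⟩ * s * ⟨(l.map V.op).prod, hl⟩ = s * t by rw [e]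
    apply Subtype.ext
    have e1 : t.1 = V.op k * (l.map V.op).prod := by
      rw [ht, List.map_cons, List.prod_cons]
    change V.op k * s.1 * _ = s.1 * t.1
    rw [e1, V.monoid_comm (V.op_mem_monoid k) s.2, mul_assoc]

/-- `‖g - g 1‖² ≤ ‖g‖² - ‖g 1‖²` for a coherent family `g`. -/
theorem coherent_sub_emb (V : CommutingIsometries ι H) (g : V.coherent) :
    ‖g - V.coherentEmb (g.1 1)‖ * ‖g - V.coherentEmb (g.1 1)‖ ≤
      ‖g‖ * ‖g‖ - ‖g.1 1‖ * ‖g.1 1‖ := by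
  refine V.coherent_sq_le _ fun t => ?_
  have e : (g - V.coherentEmb (g.1 1)).1 t = g.1 t - t.1 (g.1 1) := rfl
  have h1 : ⟪g.1 t, t.1 (g.1 1)⟫_ℂ = ⟪g.1 1, g.1 1⟫_ℂ := by
    rw [← ContinuousLinearMap.adjoint_inner_left]
    have := g.2 1 t
    rw [one_mul] at this
    rw [this]
  have h2 := norm_sub_mul_self (𝕜 := ℂ) (g.1 t) (t.1 (g.1 1))
  rw [h1, inner_self_eq_norm_mul_norm, V.monoid_norm t.2] at h2
  have h3 := mul_self_le_mul_self (norm_nonneg _) (V.coherent_apply_le g t)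
  rw [e, h2]
  linarith

theorem coherentFamily_emb (V : CommutingIsometries ι H) (i : ι) (h : H) :
    V.coherentFamily.op i (V.coherentEmb h) = V.coherentEmb (V.op i h) := by
  apply Subtype.ext; apply lp.ext; funext s
  change (V.op i * s.1) h = s.1 (V.op i h)
  rw [V.monoid_comm (V.op_mem_monoid i) s.2]; rfl

theorem coherent_exists_lt (V : CommutingIsometries ι H) (f : V.coherent) (ε : ℝ)
    (hε : 0 < ε) : ∃ s, ‖f‖ * ‖f‖ - ε * ε < ‖f.1 s‖ * ‖f.1 s‖ := by
  by_contra hcon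
  have h1 := V.coherent_sq_le f fun s => not_lt.1 fun hs => hcon ⟨s, hs⟩
  have h2 := mul_pos hε hε
  linarith

theorem coherent_approx_aux (V : CommutingIsometries ι H) (f g : V.coherent) (ε : ℝ)
    (hε : 0 < ε) (s : V.monoid) (hs : ‖f‖ * ‖f‖ - ε * ε < ‖f.1 s‖ * ‖f.1 s‖)
    (hg : ∀ t, g.1 t = f.1 (t * s)) : ‖g - V.coherentEmb (f.1 s)‖ < ε := by
  have hg1 : g.1 1 = f.1 s := by rw [hg 1, one_mul]
  have hgn : ‖g‖ ≤ ‖f‖ := by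
    refine lp.norm_le_of_forall_le (norm_nonneg _) fun t => ?_
    change ‖g.1 t‖ ≤ ‖f‖
    rw [hg t]
    exact V.coherent_apply_le f _
  have hsub := V.coherent_sub_emb g
  rw [hg1] at hsub
  have := mul_self_le_mul_self (norm_nonneg _) hgn
  exact lt_of_mul_self_lt_mul_self₀ hε.le (lt_of_le_of_lt hsub (by linarith))

theorem coherent_approx_aux' (V : CommutingIsometries ι H) (f : V.coherent) (ε : ℝ)
    (hε : 0 < ε) (s : V.monoid) (hs : ‖f‖ * ‖f‖ - ε * ε < ‖f.1 s‖ * ‖f.1 s‖)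
    (l : List ι) (hl : s.1 = (l.map V.op).prod) :
    ‖l.foldr (fun k y => V.coherentFamily.op k y) f - V.coherentEmb (f.1 s)‖ < ε := by
  have h := fun t => V.coherentFamily_foldr_apply l f t s hl
  exact V.coherent_approx_aux f _ ε hε s hs h

theorem coherentFamily_approx (V : CommutingIsometries ι H) (f : V.coherent) (ε : ℝ)
    (hε : 0 < ε) : ∃ (l : List ι) (h : H),
      ‖l.foldr (fun k y => V.coherentFamily.op k y) f - V.coherentEmb h‖ < ε := by
  have h1 := V.coherent_exists_lt f ε hε
  have h2 := fun s : V.monoid => V.exists_list_of_mem_monoid s.2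
  exact h1.elim fun s hs => (h2 s).elim fun l hl =>
    ⟨l, f.1 s, V.coherent_approx_aux' f ε hε s hs l hl⟩

/-- The space of coherent families, as a minimal unitary extension. -/
def coherentExtension (V : CommutingIsometries ι H) : V.MinimalUnitaryExtension where
  space := V.coherent
  family := V.coherentFamily
  unitary := V.coherentFamily_unitary
  emb := V.coherentEmb
  extends_op := V.coherentFamily_emb
  minimal := minimal_of_forall _ _ V.coherentFamily_approx

/-- The minimal unitary extension of the family `V` (it is unique up to unitary equivalence). -/
def minimalUnitaryExtension (V : CommutingIsometries ι H) : V.MinimalUnitaryExtension :=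
  V.coherentExtension

end Existence

section CommutantExtension

variable {ι : Type u} {H : Type v} [NormedAddCommGroup H] [InnerProductSpace ℂ H]

/-- The product of the operators of the family along a finite list of indices. -/
def word (V : CommutingIsometries ι H) (l : List ι) : H →L[ℂ] H := (l.map V.op).prod

theorem word_mem (V : CommutingIsometries ι H) (l : List ι) : V.word l ∈ V.monoid :=
  Submonoid.list_prod_mem _ fun x hx => by
    obtain ⟨i, -, rfl⟩ := List.mem_map.1 hx
    exact V.op_mem_monoid i

theorem word_nil (V : CommutingIsometries ι H) (x : H) : V.word [] x = x := rfl

theorem word_cons (V : CommutingIsometries ι H) (k : ι) (l : List ι) (x : H) :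
    V.word (k :: l) x = V.op k (V.word l x) := by
  rw [word, List.map_cons, List.prod_cons]; rfl

theorem word_append (V : CommutingIsometries ι H) (l m : List ι) (x : H) :
    V.word (l ++ m) x = V.word l (V.word m x) := by
  rw [word, List.map_append, List.prod_append]; rfl

theorem word_comm (V : CommutingIsometries ι H) (l m : List ι) (x : H) :
    V.word l (V.word m x) = V.word m (V.word l x) :=
  DFunLike.congr_fun (V.monoid_comm (V.word_mem l) (V.word_mem m)) x

theorem word_op_comm (V : CommutingIsometries ι H) (l : List ι) (i : ι) (x : H) :
    V.word l (V.op i x) = V.op i (V.word l x) :=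
  DFunLike.congr_fun (V.monoid_comm (V.word_mem l) (V.op_mem_monoid i)) x

theorem InCommutant.apply {V : CommutingIsometries ι H} {A : H →L[ℂ] H} (hA : V.InCommutant A)
    (i : ι) (x : H) : A (V.op i x) = V.op i (A x) :=
  DFunLike.congr_fun (hA i) x

theorem InCommutant.word {V : CommutingIsometries ι H} {A : H →L[ℂ] H} (hA : V.InCommutant A)
    (l : List ι) (x : H) : A (V.word l x) = V.word l (A x) := by
  induction l with
  | nil => rfl
  | cons k l ih => rw [word_cons, word_cons, hA.apply, ih]

theorem op_adjoint_of_unitary [CompleteSpace H] (V : CommutingIsometries ι H)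
    (hV : ∀ i, IsUnitaryOp (V.op i)) (i : ι) (x : H) :
    V.op i (ContinuousLinearMap.adjoint (V.op i) x) = x := by
  obtain ⟨y, rfl⟩ := (hV i).2 x
  rw [adjoint_apply_self_of_norm (V.norm_op i)]

theorem word_reverse_adjoint [CompleteSpace H] (V : CommutingIsometries ι H)
    (hV : ∀ i, IsUnitaryOp (V.op i)) (l : List ι) (x : H) :
    V.word l.reverse ((l.map fun k => ContinuousLinearMap.adjoint (V.op k)).prod x) = x := by
  induction l with
  | nil => rfl
  | cons k l ih =>
    rw [List.reverse_cons, word_append, List.map_cons, List.prod_cons, mul_apply_eq_comp,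
      word_cons, word_nil, V.op_adjoint_of_unitary hV]
    exact ih

namespace MinimalUnitaryExtension

variable {V : CommutingIsometries ι H} (E : V.MinimalUnitaryExtension)

theorem word_emb (l : List ι) (h : H) : E.family.word l (E.emb h) = E.emb (V.word l h) := by
  induction l with
  | nil => rfl
  | cons k l ih => rw [word_cons, word_cons, ih, E.extends_op]

/-- The pairs `(U_l^* h, U_l^* A h)`: the graph of the extension of `A`, before closure. -/
def extensionGraph (A : H →L[ℂ] H) (hA : V.InCommutant A) :
    Submodule ℂ (E.space × E.space) where
  carrier := {p | ∃ (l : List ι) (h : H),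
    E.family.word l p.1 = E.emb h ∧ E.family.word l p.2 = E.emb (A h)}
  zero_mem' := ⟨[], 0, by simp, by simp⟩
  add_mem' := by
    rintro p q ⟨l, h, h1, h2⟩ ⟨m, k, h3, h4⟩
    refine ⟨l ++ m, V.word m h + V.word l k, ?_, ?_⟩
    · rw [Prod.fst_add, map_add, word_append, word_append, h3, word_comm, h1, word_emb, word_emb,
        map_add]
    · rw [Prod.snd_add, map_add, word_append, word_append, h4, word_comm, h2, word_emb, word_emb,
        map_add, map_add, hA.word, hA.word]
  smul_mem' := by
    rintro c p ⟨l, h, h1, h2⟩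
    refine ⟨l, c • h, ?_, ?_⟩
    · rw [Prod.smul_fst, map_smul, h1, map_smul]
    · rw [Prod.smul_snd, map_smul, h2, map_smul, map_smul]

theorem extensionGraph_op (A : H →L[ℂ] H) (hA : V.InCommutant A) (i : ι)
    {p : E.space × E.space} (hp : p ∈ E.extensionGraph A hA) :
    (E.family.op i p.1, E.family.op i p.2) ∈ E.extensionGraph A hA := by
  obtain ⟨l, h, h1, h2⟩ := hp
  refine ⟨l, V.op i h, ?_, ?_⟩
  · rw [word_op_comm, h1, E.extends_op]
  · rw [word_op_comm, h2, E.extends_op, hA.apply]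

/-- First coordinate on the graph. -/
def graphFst (A : H →L[ℂ] H) (hA : V.InCommutant A) : E.extensionGraph A hA →ₗ[ℂ] E.space :=
  LinearMap.fst ℂ E.space E.space ∘ₗ (E.extensionGraph A hA).subtype

/-- Second coordinate on the graph. -/
def graphSnd (A : H →L[ℂ] H) (hA : V.InCommutant A) : E.extensionGraph A hA →ₗ[ℂ] E.space :=
  LinearMap.snd ℂ E.space E.space ∘ₗ (E.extensionGraph A hA).subtype

theorem graph_dense (A : H →L[ℂ] H) (hA : V.InCommutant A) :
    DenseRange (E.graphFst A hA) := by
  have h1 := Submodule.dense_iff_topologicalClosure_eq_top.2 E.minimal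
  refine h1.mono ?_
  rw [← LinearMap.coe_range, SetLike.coe_subset_coe, Submodule.span_le]
  rintro _ ⟨l, h, rfl⟩
  refine ⟨⟨(_, (l.map fun k => ContinuousLinearMap.adjoint (E.family.op k)).prod
    (E.emb (A h))), l.reverse, h, ?_, ?_⟩, rfl⟩
  · exact E.family.word_reverse_adjoint E.unitary l _
  · exact E.family.word_reverse_adjoint E.unitary l _

theorem graph_norm (A : H →L[ℂ] H) (hA : V.InCommutant A) (p : E.extensionGraph A hA) :
    ‖E.graphSnd A hA p‖ ≤ ‖A‖ * ‖E.graphFst A hA p‖ := by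
  obtain ⟨p, l, h, h1, h2⟩ := p
  change ‖p.2‖ ≤ ‖A‖ * ‖p.1‖
  rw [← E.family.monoid_norm (E.family.word_mem l) p.1,
    ← E.family.monoid_norm (E.family.word_mem l) p.2, h1, h2, E.emb.norm_map, E.emb.norm_map]
  exact A.le_opNorm h

/-- The canonical extension of an operator `A` in the commutant of `V` to the space of a minimal
unitary extension: the unique operator in the commutant of that extension whose restriction to
the original space is `A`. -/
def extend (A : H →L[ℂ] H) (hA : V.InCommutant A) : E.space →L[ℂ] E.space :=
  (E.graphSnd A hA).extendOfNorm (E.graphFst A hA)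

theorem extend_graph (A : H →L[ℂ] H) (hA : V.InCommutant A) (p : E.extensionGraph A hA) :
    E.extend A hA p.1.1 = p.1.2 :=
  LinearMap.extendOfNorm_eq (E.graph_dense A hA) ⟨_, E.graph_norm A hA⟩ p

theorem extend_emb (A : H →L[ℂ] H) (hA : V.InCommutant A) (h : H) :
    E.extend A hA (E.emb h) = E.emb (A h) :=
  E.extend_graph A hA ⟨(E.emb h, E.emb (A h)), [], h, rfl, rfl⟩

theorem norm_extend_le (A : H →L[ℂ] H) (hA : V.InCommutant A) : ‖E.extend A hA‖ ≤ ‖A‖ :=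
  LinearMap.opNorm_extendOfNorm_le (E.graph_dense A hA) (norm_nonneg A) (E.graph_norm A hA)

theorem extend_inCommutant (A : H →L[ℂ] H) (hA : V.InCommutant A) :
    E.family.InCommutant (E.extend A hA) := by
  intro i
  refine ContinuousLinearMap.coeFn_injective ?_
  refine (E.graph_dense A hA).equalizer (ContinuousLinearMap.continuous _)
    (ContinuousLinearMap.continuous _) ?_
  funext p
  change E.extend A hA (E.family.op i p.1.1) = E.family.op i (E.extend A hA p.1.1)
  rw [E.extend_graph A hA p]
  exact E.extend_graph A hA ⟨_, E.extensionGraph_op A hA i p.2⟩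

/-- The extension is determined by the two properties above. -/
theorem extend_unique (A : H →L[ℂ] H) (hA : V.InCommutant A) (B : E.space →L[ℂ] E.space)
    (hB : E.family.InCommutant B) (hBA : ∀ h, B (E.emb h) = E.emb (A h)) :
    B = E.extend A hA := by
  refine ContinuousLinearMap.coeFn_injective ?_
  refine (E.graph_dense A hA).equalizer (ContinuousLinearMap.continuous _)
    (ContinuousLinearMap.continuous _) ?_
  funext p
  change B p.1.1 = E.extend A hA p.1.1
  rw [E.extend_graph A hA p]
  obtain ⟨p, l, h, h1, h2⟩ := p
  have hi : Function.Injective (E.family.word l) := by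
    refine (injective_iff_map_eq_zero _).2 fun x hx => ?_
    rw [← norm_eq_zero, ← E.family.monoid_norm (E.family.word_mem l) x, hx, norm_zero]
  apply hi
  change E.family.word l (B p.1) = E.family.word l p.2
  rw [h2, ← hB.word, h1, hBA]

end MinimalUnitaryExtension

end CommutantExtension

section Defect

variable {E : Type v} [NormedAddCommGroup E] [InnerProductSpace ℂ E] [CompleteSpace E]

/-- The defect operator `D_T = (I - T^* T)^{1/2}` of a contraction `T`. -/
def defectOperator (T : E →L[ℂ] E) : E →L[ℂ] E :=
  CFC.sqrt (1 - ContinuousLinearMap.adjoint T * T)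

/-- The defect space: the closure of the range of the defect operator. -/
def defectSpace (T : E →L[ℂ] E) : Submodule ℂ E :=
  (LinearMap.range (defectOperator T).toLinearMap).topologicalClosure

instance (T : E →L[ℂ] E) : CompleteSpace (defectSpace T) :=
  Submodule.topologicalClosure.completeSpace _

theorem defectOperator_mem (T : E →L[ℂ] E) (x : E) : defectOperator T x ∈ defectSpace T :=
  Submodule.le_topologicalClosure _ ⟨x, rfl⟩

theorem defect_nonneg {T : E →L[ℂ] E} (hT : ‖T‖ ≤ 1) :
    0 ≤ 1 - ContinuousLinearMap.adjoint T * T := by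
  rw [sub_nonneg, ← ContinuousLinearMap.star_eq_adjoint,
    ← CStarAlgebra.norm_le_one_iff_of_nonneg (star T * T) (star_mul_self_nonneg T),
    CStarRing.norm_star_mul_self]
  exact mul_le_one₀ hT (norm_nonneg _) hT

theorem norm_sq_defectOperator {T : E →L[ℂ] E} (hT : ‖T‖ ≤ 1) (x : E) :
    ‖T x‖ ^ 2 + ‖defectOperator T x‖ ^ 2 = ‖x‖ ^ 2 := by
  have h1 : ContinuousLinearMap.adjoint (defectOperator T) = defectOperator T :=
    (IsSelfAdjoint.of_nonneg (CFC.sqrt_nonneg _)).star_eq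
  have h2 : defectOperator T * defectOperator T = 1 - ContinuousLinearMap.adjoint T * T :=
    CFC.sqrt_mul_sqrt_self _ (defect_nonneg hT)
  have h3 : ContinuousLinearMap.adjoint (defectOperator T) ∘L defectOperator T =
      1 - ContinuousLinearMap.adjoint T * T := by rw [h1]; exact h2
  rw [ContinuousLinearMap.apply_norm_sq_eq_inner_adjoint_left (defectOperator T), h3,
    ContinuousLinearMap.apply_norm_sq_eq_inner_adjoint_left T, ← inner_self_eq_norm_sq (𝕜 := ℂ) x,
    ← map_add, ← inner_add_left]
  congr 2
  change ContinuousLinearMap.adjoint T (T x) + (x - ContinuousLinearMap.adjoint T (T x)) = x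
  abel

theorem defectOperator_comm {T U : E →L[ℂ] E} (hU : IsUnitaryOp U) (hTU : T ∘L U = U ∘L T)
    (x : E) : defectOperator T (U x) = U (defectOperator T x) := by
  have h1 : ContinuousLinearMap.adjoint U * U = 1 :=
    (ContinuousLinearMap.norm_map_iff_adjoint_comp_self U).1 hU.1
  have h2 : U * ContinuousLinearMap.adjoint U = 1 := by
    refine ContinuousLinearMap.ext fun x => ?_
    obtain ⟨y, rfl⟩ := hU.2 x
    exact congrArg U (adjoint_apply_self_of_norm hU.1 y)
  have h3 : T * U = U * T := hTU
  have h4 : T * ContinuousLinearMap.adjoint U = ContinuousLinearMap.adjoint U * T := by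
    calc T * ContinuousLinearMap.adjoint U
        = ContinuousLinearMap.adjoint U * (U * T) * ContinuousLinearMap.adjoint U := by
          rw [← mul_assoc, h1, one_mul]
      _ = ContinuousLinearMap.adjoint U * T := by
          rw [← h3, ← mul_assoc, mul_assoc _ U, h2, mul_one]
  have h5 : U * ContinuousLinearMap.adjoint T = ContinuousLinearMap.adjoint T * U := by
    have := congrArg star h4
    rwa [star_mul, star_mul, ← ContinuousLinearMap.star_eq_adjoint, star_star] at this
  have h6 : Commute (1 - ContinuousLinearMap.adjoint T * T) U := by
    refine (Commute.one_left U).sub_left ?_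
    change _ * U = U * _
    rw [mul_assoc, h3, ← mul_assoc, ← h5, mul_assoc]
  exact DFunLike.congr_fun (h6.cfcₙ_nnreal NNReal.sqrt).eq x

theorem mapsTo_defectSpace {T U : E →L[ℂ] E} (hU : IsUnitaryOp U) (hTU : T ∘L U = U ∘L T) :
    ∀ x ∈ defectSpace T, U x ∈ defectSpace T := by
  have h : Set.MapsTo U (LinearMap.range (defectOperator T).toLinearMap : Set E)
      (LinearMap.range (defectOperator T).toLinearMap : Set E) := by
    rintro _ ⟨x, rfl⟩
    exact ⟨U x, defectOperator_comm hU hTU x⟩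
  exact h.closure U.continuous

end Defect

section ModelSpace

theorem memlp_two_iff {D : Type w} [NormedAddCommGroup D] {f : ℕ → D} :
    Memℓp f 2 ↔ Summable fun j => ‖f j‖ ^ 2 := by
  rw [memℓp_gen_iff (by norm_num)]
  simp

theorem lp_two_norm_sq {D : Type w} [NormedAddCommGroup D] (f : lp (fun _ : ℕ => D) 2) : ‖f‖ ^ 2 = ∑' j, ‖f j‖ ^ 2 := by
  simpa using lp.norm_rpow_eq_tsum (p := 2) (by norm_num) f

variable {H : Type v} [NormedAddCommGroup H] [InnerProductSpace ℂ H]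
  {D : Type w} [NormedAddCommGroup D] [InnerProductSpace ℂ D]

/-- The Hilbert space `H ⊕ D ⊕ D ⊕ ⋯`. -/
abbrev ModelSpace (H : Type v) [NormedAddCommGroup H] (D : Type w) [NormedAddCommGroup D] :
    Type (max v w) :=
  WithLp 2 (H × lp (fun _ : ℕ => D) 2)

/-- The sequence `(T d_0, T d_1, …)`, for an isometric operator `T`. -/
def mapSeq (T : D →L[ℂ] D) (hT : ∀ d, ‖T d‖ = ‖d‖) (f : lp (fun _ : ℕ => D) 2) :
    lp (fun _ : ℕ => D) 2 :=
  ⟨fun j => T (f j), memlp_two_iff.2 (by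
    simp only [hT]
    exact memlp_two_iff.1 (lp.memℓp f))⟩

/-- The sequence `(d, d_0, d_1, …)`. -/
def consSeq (d : D) (f : lp (fun _ : ℕ => D) 2) : lp (fun _ : ℕ => D) 2 :=
  ⟨fun j => Nat.casesOn j d fun i => f i, memlp_two_iff.2 (by
    rw [← summable_nat_add_iff 1]
    exact memlp_two_iff.1 (lp.memℓp f))⟩

/-- The operator `h ⊕ d_0 ⊕ d_1 ⊕ ⋯ ↦ V h ⊕ T d_0 ⊕ T d_1 ⊕ ⋯`, for isometric operators `V` and
`T`. -/
def diagonalIsometry (V : H →L[ℂ] H) (hV : ∀ h, ‖V h‖ = ‖h‖) (T : D →L[ℂ] D)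
    (hT : ∀ d, ‖T d‖ = ‖d‖) : ModelSpace H D →ₗᵢ[ℂ] ModelSpace H D where
  toFun x := WithLp.toLp 2 (V x.fst, mapSeq T hT x.snd)
  map_add' x y := by
    apply WithLp.ofLp_injective
    refine Prod.ext (map_add V _ _) ?_
    apply lp.ext; funext j; exact map_add T _ _
  map_smul' c x := by
    apply WithLp.ofLp_injective
    refine Prod.ext (map_smul V _ _) ?_
    apply lp.ext; funext j; exact map_smul T _ _
  norm_map' x := by
    rw [← sq_eq_sq₀ (norm_nonneg _) (norm_nonneg _), WithLp.prod_norm_sq_eq_of_L2,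
      WithLp.prod_norm_sq_eq_of_L2]
    change ‖V x.fst‖ ^ 2 + ‖mapSeq T hT x.snd‖ ^ 2 = _
    rw [hV, lp_two_norm_sq, lp_two_norm_sq]
    congr 2
    funext j
    exact congrArg (· ^ 2) (hT _)

/-- The operator `h ⊕ d_0 ⊕ d_1 ⊕ ⋯ ↦ A h ⊕ R h ⊕ d_0 ⊕ d_1 ⊕ ⋯`, for operators `A` and `R` with
`‖A h‖² + ‖R h‖² = ‖h‖²`. -/
def shiftIsometry (A : H →L[ℂ] H) (R : H →L[ℂ] D) (hAR : ∀ h, ‖A h‖ ^ 2 + ‖R h‖ ^ 2 = ‖h‖ ^ 2) :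
    ModelSpace H D →ₗᵢ[ℂ] ModelSpace H D where
  toFun x := WithLp.toLp 2 (A x.fst, consSeq (R x.fst) x.snd)
  map_add' x y := by
    apply WithLp.ofLp_injective
    refine Prod.ext (map_add A _ _) ?_
    apply lp.ext; funext j
    cases j with
    | zero => exact map_add R _ _
    | succ j => rfl
  map_smul' c x := by
    apply WithLp.ofLp_injective
    refine Prod.ext (map_smul A _ _) ?_
    apply lp.ext; funext j
    cases j with
    | zero => exact map_smul R _ _
    | succ j => rfl
  norm_map' x := by
    rw [← sq_eq_sq₀ (norm_nonneg _) (norm_nonneg _), WithLp.prod_norm_sq_eq_of_L2,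
      WithLp.prod_norm_sq_eq_of_L2]
    change ‖A x.fst‖ ^ 2 + ‖consSeq (R x.fst) x.snd‖ ^ 2 = _
    have h := (memlp_two_iff.1 (lp.memℓp (consSeq (R x.fst) x.snd))).tsum_eq_zero_add
    rw [lp_two_norm_sq, lp_two_norm_sq, h, ← add_assoc]
    exact congrArg (· + _) (hAR x.fst)

end ModelSpace

section Model

variable {n : Ordinal.{u}} {H : Type v} [NormedAddCommGroup H] [InnerProductSpace ℂ H]
  [CompleteSpace H]

/-- The space `D`, the closure of the range of the defect operator of the extension `Ã`. -/
abbrev modelDefectSpace (V : NIsometry n H) (A : H →L[ℂ] H) (hAV : V.InCommutant A) :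
    Submodule ℂ V.minimalUnitaryExtension.space :=
  defectSpace (V.minimalUnitaryExtension.extend A hAV)

/-- The operator `h ↦ D_Ã h` from `H` to the defect space. -/
def modelDefectMap (V : NIsometry n H) (A : H →L[ℂ] H) (hAV : V.InCommutant A) :
    H →L[ℂ] V.modelDefectSpace A hAV :=
  (defectOperator (V.minimalUnitaryExtension.extend A hAV) ∘L
    V.minimalUnitaryExtension.emb.toContinuousLinearMap).codRestrict _
      fun _ => defectOperator_mem _ _

theorem norm_sq_modelDefectMap (V : NIsometry n H) (A : H →L[ℂ] H) (hA : ‖A‖ ≤ 1)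
    (hAV : V.InCommutant A) (h : H) : ‖A h‖ ^ 2 + ‖V.modelDefectMap A hAV h‖ ^ 2 = ‖h‖ ^ 2 := by
  have h1 := norm_sq_defectOperator
    ((V.minimalUnitaryExtension.norm_extend_le A hAV).trans hA) (V.minimalUnitaryExtension.emb h)
  rw [V.minimalUnitaryExtension.extend_emb, LinearIsometry.norm_map, LinearIsometry.norm_map] at h1
  exact h1

/-- The operator `Ṽ_k | D`. -/
def modelRestrict (V : NIsometry n H) (A : H →L[ℂ] H) (hAV : V.InCommutant A) (k : Set.Iio n) :
    V.modelDefectSpace A hAV →L[ℂ] V.modelDefectSpace A hAV :=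
  (V.minimalUnitaryExtension.family.op k).restrict
    (mapsTo_defectSpace (V.minimalUnitaryExtension.unitary k)
      (V.minimalUnitaryExtension.extend_inCommutant A hAV k))

/-- The operators of the model `W_A`: for `k < n`,
`W_k (h ⊕ d_0 ⊕ d_1 ⊕ ⋯) = V_k h ⊕ Ṽ_k d_0 ⊕ Ṽ_k d_1 ⊕ ⋯`, and
`W_n (h ⊕ d_0 ⊕ d_1 ⊕ ⋯) = A h ⊕ D_Ã h ⊕ d_0 ⊕ d_1 ⊕ ⋯`. -/
def modelOp (V : NIsometry n H) (A : H →L[ℂ] H) (hA : ‖A‖ ≤ 1) (hAV : V.InCommutant A)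
    (k : Set.Iio (n + 1)) :
    ModelSpace H (V.modelDefectSpace A hAV) →ₗᵢ[ℂ] ModelSpace H (V.modelDefectSpace A hAV) :=
  open Classical in
  if hk : k.1 < n then
    diagonalIsometry (V.op ⟨k.1, hk⟩) (V.norm_op ⟨k.1, hk⟩) (V.modelRestrict A hAV ⟨k.1, hk⟩)
      fun d => V.minimalUnitaryExtension.family.norm_op ⟨k.1, hk⟩ d
  else
    shiftIsometry A (V.modelDefectMap A hAV) (V.norm_sq_modelDefectMap A hA hAV)

theorem modelOp_diagonal_diagonal (V : NIsometry n H) (A : H →L[ℂ] H) (hAV : V.InCommutant A)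
    (i j : Set.Iio n) (x : ModelSpace H (V.modelDefectSpace A hAV)) :
    diagonalIsometry (V.op i) (V.norm_op i) (V.modelRestrict A hAV i)
        (fun d => V.minimalUnitaryExtension.family.norm_op i d)
        (diagonalIsometry (V.op j) (V.norm_op j) (V.modelRestrict A hAV j)
          (fun d => V.minimalUnitaryExtension.family.norm_op j d) x) =
      diagonalIsometry (V.op j) (V.norm_op j) (V.modelRestrict A hAV j)
        (fun d => V.minimalUnitaryExtension.family.norm_op j d)
        (diagonalIsometry (V.op i) (V.norm_op i) (V.modelRestrict A hAV i)
          (fun d => V.minimalUnitaryExtension.family.norm_op i d) x) := by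
  apply WithLp.ofLp_injective
  refine Prod.ext (DFunLike.congr_fun (V.comm i j) x.fst) ?_
  apply lp.ext; funext m
  exact Subtype.ext (DFunLike.congr_fun (V.minimalUnitaryExtension.family.comm i j) (x.snd m).1)

theorem modelOp_diagonal_shift (V : NIsometry n H) (A : H →L[ℂ] H) (hA : ‖A‖ ≤ 1)
    (hAV : V.InCommutant A) (i : Set.Iio n) (x : ModelSpace H (V.modelDefectSpace A hAV)) :
    diagonalIsometry (V.op i) (V.norm_op i) (V.modelRestrict A hAV i)
        (fun d => V.minimalUnitaryExtension.family.norm_op i d)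
        (shiftIsometry A (V.modelDefectMap A hAV) (V.norm_sq_modelDefectMap A hA hAV) x) =
      shiftIsometry A (V.modelDefectMap A hAV) (V.norm_sq_modelDefectMap A hA hAV)
        (diagonalIsometry (V.op i) (V.norm_op i) (V.modelRestrict A hAV i)
          (fun d => V.minimalUnitaryExtension.family.norm_op i d) x) := by
  apply WithLp.ofLp_injective
  refine Prod.ext (hAV.apply i x.fst).symm ?_
  apply lp.ext; funext m
  cases m with
  | zero =>
    apply Subtype.ext
    change V.minimalUnitaryExtension.family.op i (defectOperator _
      (V.minimalUnitaryExtension.emb x.fst)) =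
        defectOperator _ (V.minimalUnitaryExtension.emb (V.op i x.fst))
    rw [← V.minimalUnitaryExtension.extends_op, defectOperator_comm
      (V.minimalUnitaryExtension.unitary i) (V.minimalUnitaryExtension.extend_inCommutant A hAV i)]
  | succ m => rfl

/-- The model `W_A`: the `(n + 1)`-isometry on `H ⊕ D ⊕ D ⊕ ⋯` associated to an `n`-isometry `V`
on `H` and a contraction `A` in the commutant of `V`. -/
def model (V : NIsometry n H) (A : H →L[ℂ] H) (hA : ‖A‖ ≤ 1) (hAV : V.InCommutant A) :
    NIsometry (n + 1) (ModelSpace H (V.modelDefectSpace A hAV)) where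
  op k := (V.modelOp A hA hAV k).toContinuousLinearMap
  norm_op k x := (V.modelOp A hA hAV k).norm_map x
  comm i j := by
    refine ContinuousLinearMap.ext fun x => ?_
    change V.modelOp A hA hAV i (V.modelOp A hA hAV j x) =
      V.modelOp A hA hAV j (V.modelOp A hA hAV i x)
    unfold modelOp
    split_ifs with hi hj hj
    · exact V.modelOp_diagonal_diagonal A hAV _ _ x
    · exact V.modelOp_diagonal_shift A hA hAV _ x
    · exact (V.modelOp_diagonal_shift A hA hAV _ x).symm
    · rfl

end Model

end CommutingIsometries

end

noncomputable section

open scoped InnerProductSpace ENNReal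

/-! Write `W₀` for the first `n` operators of `W` and `S` for the last one. The vectors lying in the
range of every word in `W₀` form the largest subspace `N` reducing `W₀` to a unitary family
(`isReducing_unitaryPart`, `le_unitaryPart_of_forall_exists`). Since `S` commutes with `W₀`, it maps
`N` into itself.

From pure to model, take `H = Nᗮ`, let `V` be the restriction of `W₀` to `H`, which is completely
nonunitary, and split `S h = A h + X h` along `H ⊕ N`. Pythagoras gives `‖X h‖² = ‖h‖² - ‖A h‖²`,
which is the squared norm of the defect vector `D_Ã h`. As `X` intertwines `V` with the unitary part
of `W₀`, the rule `D_Ã Ṽ_l^* h ↦ W_l^* X h` extends to an isometry `Φ` of the defect space into `N`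
(`exists_defect_isometry`). Its range is orthogonal to `S N`, so the spaces `S^j Φ D` are mutually
orthogonal (`orthogonalFamily_powIsometry`), and together with `H` they carry a copy of the model
inside `W`. What is left over is reducing and lies in `N`, so `W₀` is unitary on it and pureness
makes it zero (`unitarilyEquivalent_model`).

From model to pure, let `M` reduce the model with the first `n` operators unitary on it. The
`H`-coordinates of `M` lie in the unitary part of `V`, hence vanish. Applying the adjoint of the
last operator, which preserves `M`, shows that the zeroth defect coordinate is orthogonal to the
vectors `D_Ã h`; the words spread this to the whole defect space. The same adjoint shifts
coordinates down, so all the others vanish too (`isPure_of_unitarilyEquivalent_model`). -/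

theorem inner_map_map_of_norm {E : Type v} {F : Type w} [NormedAddCommGroup E]
    [InnerProductSpace ℂ E] [NormedAddCommGroup F] [InnerProductSpace ℂ F] {T : E →L[ℂ] F}
    (hT : ∀ x, ‖T x‖ = ‖x‖) (x y : E) : ⟪T x, T y⟫_ℂ = ⟪x, y⟫_ℂ :=
  (LinearMap.norm_map_iff_inner_map_map T).1 hT x y

/-- A subspace whose complement is invariant is invariant under preimages along an isometry. -/
theorem mem_of_isometry_mem {E : Type v} [NormedAddCommGroup E] [InnerProductSpace ℂ E]
    {T : E →L[ℂ] E} (hT : ∀ x, ‖T x‖ = ‖x‖) {M : Submodule ℂ E} [M.HasOrthogonalProjection]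
    (hM : Set.MapsTo T Mᗮ (Mᗮ : Submodule ℂ E)) {x : E} (hx : T x ∈ M) : x ∈ M := by
  rw [← M.orthogonal_orthogonal, Submodule.mem_orthogonal]
  intro y hy
  rw [← inner_map_map_of_norm hT]
  exact Submodule.inner_left_of_mem_orthogonal hx (hM hy)

namespace CommutingIsometries

/-! ### The unitary part of a commuting family of isometries -/

section UnitaryPart

variable {ι : Type u} {H : Type v} [NormedAddCommGroup H] [InnerProductSpace ℂ H]

theorem norm_word (V : CommutingIsometries ι H) (l : List ι) (x : H) : ‖V.word l x‖ = ‖x‖ :=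
  V.monoid_norm (V.word_mem l) x

theorem word_injective (V : CommutingIsometries ι H) (l : List ι) :
    Function.Injective (V.word l) :=
  (AddMonoidHomClass.isometry_of_norm (V.word l) (V.norm_word l)).injective

/-- The vectors in the range of every product of operators of the family. -/
def unitaryPart (V : CommutingIsometries ι H) : Submodule ℂ H :=
  ⨅ l : List ι, LinearMap.range (V.word l).toLinearMap

theorem mem_unitaryPart {V : CommutingIsometries ι H} {x : H} :
    x ∈ V.unitaryPart ↔ ∀ l, ∃ y, V.word l y = x := by
  simp [unitaryPart]

theorem isClosed_unitaryPart [CompleteSpace H] (V : CommutingIsometries ι H) :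
    IsClosed (V.unitaryPart : Set H) := by
  rw [unitaryPart, Submodule.coe_iInf]
  refine isClosed_iInter fun l => ?_
  exact (AddMonoidHomClass.isometry_of_norm (V.word l)
    (V.norm_word l)).isClosedEmbedding.isClosed_range

/-- An operator of the commutant passes through each word. Besides the members of the family, this
is applied to the last operator of an `(n + 1)`-isometry. -/
theorem map_mem_unitaryPart {V : CommutingIsometries ι H} {A : H →L[ℂ] H}
    (hA : V.InCommutant A) {x : H} (hx : x ∈ V.unitaryPart) : A x ∈ V.unitaryPart := by
  rw [mem_unitaryPart] at hx ⊢
  intro l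
  obtain ⟨y, rfl⟩ := hx l
  exact ⟨A y, (hA.word l y).symm⟩

theorem inCommutant_op (V : CommutingIsometries ι H) (i : ι) : V.InCommutant (V.op i) :=
  V.comm i

theorem op_mem_unitaryPart (V : CommutingIsometries ι H) (i : ι) {x : H}
    (hx : x ∈ V.unitaryPart) : V.op i x ∈ V.unitaryPart :=
  map_mem_unitaryPart (V.inCommutant_op i) hx

theorem mem_unitaryPart_of_word_mem (V : CommutingIsometries ι H) (l : List ι) {x : H}
    (hx : V.word l x ∈ V.unitaryPart) : x ∈ V.unitaryPart := by
  rw [mem_unitaryPart] at hx ⊢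
  intro m
  obtain ⟨y, hy⟩ := hx (l ++ m)
  exact ⟨y, V.word_injective l (by rw [← word_append, hy])⟩

theorem exists_mem_unitaryPart (V : CommutingIsometries ι H) (l : List ι) {x : H}
    (hx : x ∈ V.unitaryPart) : ∃ y ∈ V.unitaryPart, V.word l y = x := by
  obtain ⟨y, rfl⟩ := mem_unitaryPart.1 hx l
  exact ⟨y, V.mem_unitaryPart_of_word_mem l hx, rfl⟩

/-- The complement is invariant because each operator maps the unitary part onto itself and
preserves inner products: a vector of the part can be written `V_i z`, and `⟪V_i z, V_i x⟫ = ⟪z,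
x⟫`. -/
theorem isReducing_unitaryPart [CompleteSpace H] (V : CommutingIsometries ι H) :
    V.IsReducing V.unitaryPart where
  isClosed := V.isClosed_unitaryPart
  invariant i _ hx := V.op_mem_unitaryPart i hx
  invariant_orthogonal i x hx := by
    refine (Submodule.mem_orthogonal _ _).2 fun y hy => ?_
    obtain ⟨z, hz, rfl⟩ := V.exists_mem_unitaryPart [i] hy
    change ⟪V.op i z, V.op i x⟫_ℂ = 0
    rw [inner_map_map_of_norm (V.norm_op i)]
    exact Submodule.inner_right_of_mem_orthogonal hz hx

/-- Maximality of the unitary part: preimages can be taken inside `M` one letter at a time. -/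
theorem le_unitaryPart_of_forall_exists (V : CommutingIsometries ι H) (M : Submodule ℂ H)
    (hM : ∀ i, ∀ x ∈ M, ∃ y ∈ M, V.op i y = x) : M ≤ V.unitaryPart := by
  intro x hx
  rw [mem_unitaryPart]
  intro l
  suffices h : ∃ y ∈ M, V.word l y = x from ⟨h.choose, h.choose_spec.2⟩
  induction l generalizing x with
  | nil => exact ⟨x, hx, rfl⟩
  | cons k l ih =>
    obtain ⟨y, hy, rfl⟩ := hM k x hx
    obtain ⟨z, hz, rfl⟩ := ih hy
    exact ⟨z, hz, V.word_cons k l z⟩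

theorem restrict_isUnitaryOn_iff (V : CommutingIsometries ι H) (M : Submodule ℂ H)
    (hM : V.IsInvariant M) (J : Set ι) :
    (V.restrict M hM).IsUnitaryOn J ↔ ∀ j ∈ J, ∀ x ∈ M, ∃ y ∈ M, V.op j y = x := by
  constructor
  · intro h j hj x hx
    obtain ⟨y, hy⟩ := (h j hj).2 ⟨x, hx⟩
    exact ⟨y, y.2, congrArg Subtype.val hy⟩
  · intro h j hj
    refine ⟨(V.restrict M hM).norm_op j, fun x => ?_⟩
    obtain ⟨y, hy, hyx⟩ := h j hj x x.2
    exact ⟨⟨y, hy⟩, Subtype.ext hyx⟩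

theorem isCompletelyNonunitary_iff [CompleteSpace H] (V : CommutingIsometries ι H) :
    V.IsCompletelyNonunitary ↔ V.unitaryPart = ⊥ := by
  constructor
  · intro h
    refine h _ V.isReducing_unitaryPart ?_
    rw [restrict_isUnitaryOn_iff]
    exact fun i _ x hx => V.exists_mem_unitaryPart [i] hx
  · intro h M hM hu
    rw [restrict_isUnitaryOn_iff] at hu
    rw [eq_bot_iff, ← h]
    exact V.le_unitaryPart_of_forall_exists M fun i => hu i trivial

end UnitaryPart

/-! ### Splitting an `(n + 1)`-isometry into its first `n` operators and the last -/

section Parts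

variable {n : Ordinal.{u}} {K : Type v} [NormedAddCommGroup K] [InnerProductSpace ℂ K]

/-- The index `k < n`, as an index of an `(n + 1)`-isometry. -/
def castIndex (k : Set.Iio n) : Set.Iio (n + 1) :=
  ⟨k.1, Set.mem_Iio.2 ((Set.mem_Iio.1 k.2).trans (Order.lt_add_one_iff.2 le_rfl))⟩

/-- The last index of an `(n + 1)`-isometry. -/
def lastIndex (n : Ordinal.{u}) : Set.Iio (n + 1) :=
  ⟨n, Set.mem_Iio.2 (Order.lt_add_one_iff.2 le_rfl)⟩

theorem forall_index_iff {p : Set.Iio (n + 1) → Prop} :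
    (∀ k, p k) ↔ (∀ k, p (castIndex k)) ∧ p (lastIndex n) := by
  refine ⟨fun h => ⟨fun k => h _, h _⟩, fun h k => ?_⟩
  rcases (Order.lt_add_one_iff.1 (Set.mem_Iio.1 k.2)).lt_or_eq with hk | hk
  · exact h.1 ⟨k.1, hk⟩
  · have : k = lastIndex n := Subtype.ext hk
    exact this ▸ h.2

/-- The first `n` operators of an `(n + 1)`-isometry. -/
def initial (W : NIsometry (n + 1) K) : NIsometry n K where
  op k := W.op (castIndex k)
  norm_op _ := W.norm_op _
  comm _ _ := W.comm _ _

/-- The last operator of an `(n + 1)`-isometry. -/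
def last (W : NIsometry (n + 1) K) : K →L[ℂ] K := W.op (lastIndex n)

theorem norm_last (W : NIsometry (n + 1) K) (x : K) : ‖W.last x‖ = ‖x‖ := W.norm_op _ x

theorem inCommutant_last (W : NIsometry (n + 1) K) : W.initial.InCommutant W.last :=
  fun _ => W.comm _ _

theorem isInvariant_iff (W : NIsometry (n + 1) K) (M : Submodule ℂ K) :
    W.IsInvariant M ↔ W.initial.IsInvariant M ∧ Set.MapsTo W.last M M :=
  forall_index_iff

/-- Pureness of an `(n + 1)`-isometry with respect to its first `n` operators. -/
theorem isPure_initial_iff (W : NIsometry (n + 1) K) :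
    W.IsPure {k : Set.Iio (n + 1) | k.1 < n} ↔ ∀ M : Submodule ℂ K, W.IsReducing M →
      (∀ k, ∀ x ∈ M, ∃ y ∈ M, W.initial.op k y = x) → M = ⊥ := by
  refine forall_congr' fun M => forall_congr' fun hM => ?_
  rw [restrict_isUnitaryOn_iff]
  refine imp_congr_left ⟨fun h k => h (castIndex k) k.2, fun h j hj => h ⟨j.1, hj⟩⟩

end Parts

/-! ### Coordinates of the model operators -/

section ModelFormulas

variable {n : Ordinal.{u}} {H : Type v} [NormedAddCommGroup H] [InnerProductSpace ℂ H]
  [CompleteSpace H] (V : NIsometry n H) (A : H →L[ℂ] H) (hA : ‖A‖ ≤ 1) (hAV : V.InCommutant A)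

theorem model_initial_apply (k : Set.Iio n) (x : ModelSpace H (V.modelDefectSpace A hAV)) :
    (V.model A hA hAV).initial.op k x = diagonalIsometry (V.op k) (V.norm_op k)
      (V.modelRestrict A hAV k) (fun d => V.minimalUnitaryExtension.family.norm_op k d) x := by
  have hk : (castIndex k).1 < n := k.2
  change V.modelOp A hA hAV (castIndex k) x = _
  rw [modelOp, dif_pos hk]
  rfl

theorem model_last_apply (x : ModelSpace H (V.modelDefectSpace A hAV)) :
    (V.model A hA hAV).last x = shiftIsometry A (V.modelDefectMap A hAV)
      (V.norm_sq_modelDefectMap A hA hAV) x := by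
  have hk : ¬ (lastIndex n).1 < n := lt_irrefl n
  change V.modelOp A hA hAV (lastIndex n) x = _
  rw [modelOp, dif_neg hk]

theorem model_initial_fst (k : Set.Iio n) (x : ModelSpace H (V.modelDefectSpace A hAV)) :
    ((V.model A hA hAV).initial.op k x).fst = V.op k x.fst := by
  rw [model_initial_apply]; rfl

theorem model_initial_snd (k : Set.Iio n) (x : ModelSpace H (V.modelDefectSpace A hAV)) (j : ℕ) :
    ((V.model A hA hAV).initial.op k x).snd j = V.modelRestrict A hAV k (x.snd j) := by
  rw [model_initial_apply]; rfl

theorem model_last_fst (x : ModelSpace H (V.modelDefectSpace A hAV)) :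
    ((V.model A hA hAV).last x).fst = A x.fst := by
  rw [model_last_apply]; rfl

theorem model_last_snd_zero (x : ModelSpace H (V.modelDefectSpace A hAV)) :
    ((V.model A hA hAV).last x).snd 0 = V.modelDefectMap A hAV x.fst := by
  rw [model_last_apply]; rfl

theorem model_last_snd_succ (x : ModelSpace H (V.modelDefectSpace A hAV)) (j : ℕ) :
    ((V.model A hA hAV).last x).snd (j + 1) = x.snd j := by
  rw [model_last_apply]; rfl

theorem coe_modelDefectMap (h : H) : (V.modelDefectMap A hAV h : V.minimalUnitaryExtension.space) =
    defectOperator (V.minimalUnitaryExtension.extend A hAV) (V.minimalUnitaryExtension.emb h) :=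
  rfl

end ModelFormulas

end CommutingIsometries

theorem denseRange_defectOperator_codRestrict {E : Type v} [NormedAddCommGroup E]
    [InnerProductSpace ℂ E] [CompleteSpace E] (T : E →L[ℂ] E) :
    DenseRange fun x => (⟨CommutingIsometries.defectOperator T x,
      CommutingIsometries.defectOperator_mem T x⟩ : CommutingIsometries.defectSpace T) := by
  intro d
  rw [Topology.IsInducing.subtypeVal.closure_eq_preimage_closure_image]
  change d.1 ∈ closure _
  rw [← Set.range_comp]
  exact d.2

namespace CommutingIsometries

/-! ### Density in the minimal unitary extension, and words against the defect operator -/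

section Extension

variable {ι : Type u} {H : Type v} [NormedAddCommGroup H] [InnerProductSpace ℂ H]

theorem MinimalUnitaryExtension.dense_word_mem {V : CommutingIsometries ι H}
    (E : V.MinimalUnitaryExtension) :
    Dense {x : E.space | ∃ (l : List ι) (h : H), E.family.word l x = E.emb h} := by
  -- Only first coordinates of the extension graph matter here, so the zero operator serves.
  have hA : V.InCommutant (0 : H →L[ℂ] H) := fun i => by ext; simp
  refine (E.graph_dense 0 hA).mono ?_
  rintro _ ⟨⟨p, l, h, h1, -⟩, rfl⟩
  exact ⟨l, h, h1⟩

theorem word_defectOperator {E : Type v} [NormedAddCommGroup E] [InnerProductSpace ℂ E]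
    [CompleteSpace E] (U : CommutingIsometries ι E) (hU : ∀ i, IsUnitaryOp (U.op i))
    {T : E →L[ℂ] E} (hT : U.InCommutant T) (l : List ι) (x : E) :
    U.word l (defectOperator T x) = defectOperator T (U.word l x) := by
  induction l with
  | nil => rfl
  | cons k l ih => rw [word_cons, word_cons, ih, defectOperator_comm (hU k) (hT k)]

end Extension

/-! ### The model of a completely nonunitary family is pure -/

section Pure

variable {n : Ordinal.{u}} {H : Type v} [NormedAddCommGroup H] [InnerProductSpace ℂ H]
  [CompleteSpace H] (V : NIsometry n H) (A : H →L[ℂ] H) (hA : ‖A‖ ≤ 1) (hAV : V.InCommutant A)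

theorem model_word_fst (l : List (Set.Iio n)) (x : ModelSpace H (V.modelDefectSpace A hAV)) :
    ((V.model A hA hAV).initial.word l x).fst = V.word l x.fst := by
  induction l with
  | nil => rfl
  | cons k l ih => rw [word_cons, word_cons, model_initial_fst, ih]

theorem model_word_snd (l : List (Set.Iio n)) (x : ModelSpace H (V.modelDefectSpace A hAV))
    (j : ℕ) : (((V.model A hA hAV).initial.word l x).snd j : V.minimalUnitaryExtension.space) =
      V.minimalUnitaryExtension.family.word l (x.snd j) := by
  induction l with
  | nil => rfl
  | cons k l ih =>
    rw [word_cons, word_cons, model_initial_snd, ← ih]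
    rfl

/-- A vector of the defect space orthogonal, together with its images under the extension, to the
defect vectors of the original space vanishes. -/
theorem eq_zero_of_inner_modelDefectMap (d : V.modelDefectSpace A hAV)
    (hd : ∀ (l : List (Set.Iio n)) (h : H),
      ⟪V.minimalUnitaryExtension.family.word l (d : V.minimalUnitaryExtension.space),
        (V.modelDefectMap A hAV h : V.minimalUnitaryExtension.space)⟫_ℂ = 0) : d = 0 := by
  have h1 : ∀ x : V.minimalUnitaryExtension.space,
      ⟪(d : V.minimalUnitaryExtension.space),
        defectOperator (V.minimalUnitaryExtension.extend A hAV) x⟫_ℂ = 0 := by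
    refine V.minimalUnitaryExtension.dense_word_mem.induction ?_
      (isClosed_eq (by fun_prop) continuous_const)
    rintro x ⟨l, h, hx⟩
    -- For `U_l x = h` in the original space, `⟪d, D x⟫ = ⟪U_l d, U_l D x⟫ = ⟪U_l d, D h⟫`.
    rw [← inner_map_map_of_norm (V.minimalUnitaryExtension.family.norm_word l),
      word_defectOperator _ V.minimalUnitaryExtension.unitary
        (V.minimalUnitaryExtension.extend_inCommutant A hAV), hx]
    exact hd l h
  have h2 : ∀ e : V.modelDefectSpace A hAV, ⟪d, e⟫_ℂ = 0 := by
    refine fun e => (denseRange_defectOperator_codRestrict _).induction_on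
      (p := fun e => ⟪d, e⟫_ℂ = 0) e (isClosed_eq (by fun_prop) continuous_const) h1
  exact inner_self_eq_zero.1 (h2 d)

variable {K : Type w} [NormedAddCommGroup K] [InnerProductSpace ℂ K]
  {W : NIsometry (n + 1) K}
  {Φ : K ≃ₗᵢ[ℂ] ModelSpace H (V.modelDefectSpace A hAV)}

theorem word_intertwine (hΦ : ∀ i x, Φ (W.op i x) = (V.model A hA hAV).op i (Φ x))
    (l : List (Set.Iio n)) (x : K) :
    Φ (W.initial.word l x) = (V.model A hA hAV).initial.word l (Φ x) := by
  induction l with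
  | nil => rfl
  | cons k l ih =>
    rw [word_cons, word_cons, ← ih]
    exact hΦ _ _

theorem word_mem_of_isReducing {M : Submodule ℂ K} (hM : W.IsReducing M)
    (l : List (Set.Iio n)) {x : K} (hx : x ∈ M) : W.initial.word l x ∈ M := by
  induction l with
  | nil => exact hx
  | cons k l ih =>
    rw [word_cons]
    exact hM.invariant _ ih

variable [CompleteSpace K]

/-- The witness is `S^* x` for the last operator `S`; it stays in `M` because `S` preserves `Mᗮ`.
Expressing it by inner products avoids computing the adjoint on the model space. -/
theorem exists_adjoint_last {M : Submodule ℂ K} (hM : W.IsReducing M)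
    (hΦ : ∀ i x, Φ (W.op i x) = (V.model A hA hAV).op i (Φ x)) {x : K} (hx : x ∈ M) :
    ∃ y ∈ M, ∀ u, ⟪Φ y, u⟫_ℂ = ⟪Φ x, (V.model A hA hAV).last u⟫_ℂ := by
  have := hM.isClosed.completeSpace_coe
  refine ⟨ContinuousLinearMap.adjoint W.last x, ?_, fun u => ?_⟩
  · rw [← M.orthogonal_orthogonal, Submodule.mem_orthogonal]
    intro z hz
    rw [ContinuousLinearMap.adjoint_inner_right]
    exact Submodule.inner_left_of_mem_orthogonal hx (hM.invariant_orthogonal _ hz)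
  · obtain ⟨z, rfl⟩ := Φ.surjective u
    rw [Φ.inner_map_map, ContinuousLinearMap.adjoint_inner_left, ← Φ.inner_map_map]
    exact congrArg _ (hΦ _ z)

theorem isPure_of_unitarilyEquivalent_model (hV : V.IsCompletelyNonunitary)
    (hW : W.UnitarilyEquivalent (V.model A hA hAV)) :
    W.IsPure {k : Set.Iio (n + 1) | k.1 < n} := by
  classical
  obtain ⟨Φ, hΦ⟩ := hW
  rw [isCompletelyNonunitary_iff] at hV
  rw [isPure_initial_iff]
  intro M hM hu
  -- `M` lies in the unitary part of the first `n` operators, and the first coordinate carries words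
  -- to words, so it lands in the unitary part of `V`.
  have h1 : ∀ x ∈ M, (Φ x).fst = 0 := by
    intro x hx
    rw [← Submodule.mem_bot ℂ, ← hV, mem_unitaryPart]
    intro l
    obtain ⟨y, rfl⟩ := mem_unitaryPart.1 (W.initial.le_unitaryPart_of_forall_exists M hu hx) l
    exact ⟨(Φ y).fst, by rw [V.word_intertwine A hA hAV hΦ, model_word_fst]⟩
  have h2 : ∀ x ∈ M, ∀ h : H, ⟪(Φ x).snd 0, V.modelDefectMap A hAV h⟫_ℂ = 0 := by
    intro x hx h
    obtain ⟨y, hy, hyx⟩ := V.exists_adjoint_last A hA hAV hM hΦ hx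
    -- Testing against `h ⊕ 0` isolates the zeroth defect coordinate: the other terms contain the
    -- first coordinates of `x` and `y`, both zero.
    have h3 := hyx (WithLp.toLp 2 (h, 0))
    have h4 : (V.model A hA hAV).last (WithLp.toLp 2 (h, 0)) =
        WithLp.toLp 2 (A h, lp.single 2 0 (V.modelDefectMap A hAV h)) := by
      apply WithLp.ofLp_injective
      refine Prod.ext (V.model_last_fst A hA hAV _) ?_
      apply lp.ext; funext j
      cases j with
      | zero => exact (V.model_last_snd_zero A hA hAV _).trans (by simp)
      | succ j => exact (V.model_last_snd_succ A hA hAV _ j).trans (by simp)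
    rw [h4, WithLp.prod_inner_apply, WithLp.prod_inner_apply] at h3
    change ⟪(Φ y).fst, h⟫_ℂ + ⟪(Φ y).snd, 0⟫_ℂ = ⟪(Φ x).fst, A h⟫_ℂ + ⟪(Φ x).snd, _⟫_ℂ at h3
    rw [h1 x hx, h1 y hy, lp.inner_single_right] at h3
    simpa using h3.symm
  have h3 : ∀ x ∈ M, (Φ x).snd 0 = 0 := by
    intro x hx
    refine V.eq_zero_of_inner_modelDefectMap A hAV _ fun l h => ?_
    -- `M` is stable under words, so the orthogonality just proved also holds for the images of the
    -- coordinate under words.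
    rw [← V.model_word_snd A hA hAV, ← V.word_intertwine A hA hAV hΦ]
    exact h2 _ (word_mem_of_isReducing hM l hx) h
  -- The coordinate of index `j + 1` of `x` is the coordinate of index `j` of `S^* x`, again a
  -- vector of `M`; hence the induction runs over all of `M` at once.
  have h4 : ∀ (j : ℕ), ∀ x ∈ M, (Φ x).snd j = 0 := by
    intro j
    induction j with
    | zero => exact h3
    | succ j ih =>
      intro x hx
      obtain ⟨y, hy, hyx⟩ := V.exists_adjoint_last A hA hAV hM hΦ hx
      refine ext_inner_right ℂ fun d => ?_
      have h5 := hyx (WithLp.toLp 2 (0, lp.single 2 j d))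
      have h6 : (V.model A hA hAV).last (WithLp.toLp 2 (0, lp.single 2 j d)) =
          WithLp.toLp 2 (0, lp.single 2 (j + 1) d) := by
        apply WithLp.ofLp_injective
        refine Prod.ext ((V.model_last_fst A hA hAV _).trans (map_zero A)) ?_
        apply lp.ext; funext i
        cases i with
        | zero => exact (V.model_last_snd_zero A hA hAV _).trans (by simp)
        | succ i =>
          refine (V.model_last_snd_succ A hA hAV _ i).trans ?_
          simp [Pi.single_apply]
      rw [h6, WithLp.prod_inner_apply, WithLp.prod_inner_apply] at h5
      change ⟪(Φ y).fst, 0⟫_ℂ + ⟪(Φ y).snd, _⟫_ℂ = ⟪(Φ x).fst, 0⟫_ℂ + ⟪(Φ x).snd, _⟫_ℂ at h5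
      rw [lp.inner_single_right, lp.inner_single_right, ih y hy] at h5
      simpa using h5.symm
  rw [eq_bot_iff]
  intro x hx
  rw [Submodule.mem_bot, ← Φ.map_eq_zero_iff]
  apply WithLp.ofLp_injective
  refine Prod.ext (h1 x hx) ?_
  apply lp.ext; funext j
  exact h4 j x hx

end Pure

/-! ### Embedding a defect space by means of an intertwiner -/

section DefectIsometry

variable {ι : Type u} {H : Type v} [NormedAddCommGroup H] [InnerProductSpace ℂ H]
  {K : Type w} [NormedAddCommGroup K] [InnerProductSpace ℂ K]
  {V : CommutingIsometries ι H} (E : V.MinimalUnitaryExtension) (W : CommutingIsometries ι K)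
  {X : H →L[ℂ] K}

theorem intertwine_word (hX : ∀ i h, X (V.op i h) = W.op i (X h)) (l : List ι) (h : H) :
    X (V.word l h) = W.word l (X h) := by
  induction l with
  | nil => rfl
  | cons k l ih => rw [word_cons, word_cons, hX, ih]

/-- The pairs `(U_l^* h, W_l^* X h)`, for an operator `X` that intertwines `V` and `W`. -/
def intertwinerGraph (hX : ∀ i h, X (V.op i h) = W.op i (X h)) : Submodule ℂ (E.space × K) where
  carrier := {p | ∃ (l : List ι) (h : H),
    E.family.word l p.1 = E.emb h ∧ W.word l p.2 = X h}
  zero_mem' := ⟨[], 0, by simp, by simp⟩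
  add_mem' := by
    rintro p q ⟨l, h, h1, h2⟩ ⟨m, k, h3, h4⟩
    refine ⟨l ++ m, V.word m h + V.word l k, ?_, ?_⟩
    · rw [Prod.fst_add, map_add, word_append, word_append, h3, word_comm, h1, E.word_emb,
        E.word_emb, map_add]
    · rw [Prod.snd_add, map_add, word_append, word_append, h4, word_comm, h2, map_add,
        intertwine_word W hX, intertwine_word W hX]
  smul_mem' := by
    rintro c p ⟨l, h, h1, h2⟩
    refine ⟨l, c • h, ?_, ?_⟩
    · rw [Prod.smul_fst, map_smul, h1, map_smul]
    · rw [Prod.smul_snd, map_smul, h2, map_smul]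

/-- The map `(x, y) ↦ D_T x` on the graph. -/
def intertwinerGraphFst (hX : ∀ i h, X (V.op i h) = W.op i (X h)) (T : E.space →L[ℂ] E.space) :
    intertwinerGraph E W hX →ₗ[ℂ] defectSpace T :=
  ((defectOperator T).codRestrict _ (defectOperator_mem T)).toLinearMap ∘ₗ
    LinearMap.fst ℂ E.space K ∘ₗ (intertwinerGraph E W hX).subtype

/-- The map `(x, y) ↦ y` on the graph. -/
def intertwinerGraphSnd (hX : ∀ i h, X (V.op i h) = W.op i (X h)) :
    intertwinerGraph E W hX →ₗ[ℂ] K :=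
  LinearMap.snd ℂ E.space K ∘ₗ (intertwinerGraph E W hX).subtype

variable {E W}

/-- `W_l^* X h` makes sense as a preimage under the word because `X h` lies in the range of every
word. -/
theorem exists_mem_intertwinerGraph {x : E.space} {l : List ι} {h : H}
    (hX : ∀ i h, X (V.op i h) = W.op i (X h)) (hXu : ∀ h, X h ∈ W.unitaryPart)
    (hx : E.family.word l x = E.emb h) : ∃ y, (x, y) ∈ intertwinerGraph E W hX := by
  obtain ⟨y, hy⟩ := mem_unitaryPart.1 (hXu h) l
  exact ⟨y, l, h, hx, hy⟩

theorem denseRange_intertwinerGraphFst (hX : ∀ i h, X (V.op i h) = W.op i (X h))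
    (hXu : ∀ h, X h ∈ W.unitaryPart) (T : E.space →L[ℂ] E.space) :
    DenseRange (intertwinerGraphFst E W hX T) := by
  have h1 := (denseRange_defectOperator_codRestrict T).dense_image
    ((defectOperator T).continuous.subtype_mk (defectOperator_mem T)) E.dense_word_mem
  refine h1.mono ?_
  rintro _ ⟨x, ⟨l, h, hx⟩, rfl⟩
  obtain ⟨y, hy⟩ := exists_mem_intertwinerGraph hX hXu hx
  exact ⟨⟨(x, y), hy⟩, rfl⟩

/-- Words are isometric on both sides and commute with the defect operator, so the equality of norms
on the original space passes to `U_l^* h`. It also makes the assignment `D_T x ↦ y` well defined. -/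
theorem norm_intertwinerGraph (hX : ∀ i h, X (V.op i h) = W.op i (X h))
    {T : E.space →L[ℂ] E.space} (hT : E.family.InCommutant T)
    (hXT : ∀ h, ‖X h‖ = ‖defectOperator T (E.emb h)‖) (p : intertwinerGraph E W hX) :
    ‖intertwinerGraphSnd E W hX p‖ = ‖intertwinerGraphFst E W hX T p‖ := by
  obtain ⟨p, l, h, h1, h2⟩ := p
  change ‖p.2‖ = ‖defectOperator T p.1‖
  rw [← W.norm_word l, h2, hXT, ← h1, ← word_defectOperator _ E.unitary hT, norm_word]

variable [CompleteSpace K]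

/-- The isometry `D_T U_l^* h ↦ W_l^* X h` from the defect space of `T`. -/
def defectIsometry (hX : ∀ i h, X (V.op i h) = W.op i (X h)) (hXu : ∀ h, X h ∈ W.unitaryPart)
    {T : E.space →L[ℂ] E.space} (hT : E.family.InCommutant T)
    (hXT : ∀ h, ‖X h‖ = ‖defectOperator T (E.emb h)‖) : defectSpace T →ₗᵢ[ℂ] K where
  toLinearMap := ((intertwinerGraphSnd E W hX).extendOfNorm
    (intertwinerGraphFst E W hX T)).toLinearMap
  norm_map' d := by
    refine (denseRange_intertwinerGraphFst hX hXu T).induction_on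
      (p := fun d => ‖(intertwinerGraphSnd E W hX).extendOfNorm
        (intertwinerGraphFst E W hX T) d‖ = ‖d‖) d (isClosed_eq (by fun_prop) (by fun_prop))
      fun p => ?_
    rw [LinearMap.extendOfNorm_eq (denseRange_intertwinerGraphFst hX hXu T)
      ⟨1, fun q => by rw [norm_intertwinerGraph hX hT hXT q, one_mul]⟩,
      norm_intertwinerGraph hX hT hXT]

theorem defectIsometry_graph (hX : ∀ i h, X (V.op i h) = W.op i (X h))
    (hXu : ∀ h, X h ∈ W.unitaryPart)
    {T : E.space →L[ℂ] E.space} (hT : E.family.InCommutant T)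
    (hXT : ∀ h, ‖X h‖ = ‖defectOperator T (E.emb h)‖) (p : intertwinerGraph E W hX) :
    defectIsometry hX hXu hT hXT (intertwinerGraphFst E W hX T p) =
      intertwinerGraphSnd E W hX p :=
  LinearMap.extendOfNorm_eq (denseRange_intertwinerGraphFst hX hXu T)
    ⟨1, fun q => by rw [norm_intertwinerGraph hX hT hXT q, one_mul]⟩ p

/-- Each property is checked on the dense set of vectors `D_T U_l^* h` and is closed. The last
clause transports orthogonality from the vectors `X h` to the whole range of `Φ`; it will be used
with `S` the image of the unitary part under the last operator. -/
theorem exists_defect_isometry (hX : ∀ i h, X (V.op i h) = W.op i (X h))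
    (hXu : ∀ h, X h ∈ W.unitaryPart)
    {T : E.space →L[ℂ] E.space} (hT : E.family.InCommutant T)
    (hXT : ∀ h, ‖X h‖ = ‖defectOperator T (E.emb h)‖) :
    ∃ Φ : defectSpace T →ₗᵢ[ℂ] K,
      (∀ h, Φ ⟨defectOperator T (E.emb h), defectOperator_mem T _⟩ = X h) ∧
      (∀ i (d e : defectSpace T), (e : E.space) = E.family.op i d → Φ e = W.op i (Φ d)) ∧
      (∀ d, Φ d ∈ W.unitaryPart) ∧
      ∀ S : Set K, (∀ i, ∀ z ∈ S, W.op i z ∈ S) → (∀ h, ∀ z ∈ S, ⟪X h, z⟫_ℂ = 0) →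
        ∀ d, ∀ z ∈ S, ⟪Φ d, z⟫_ℂ = 0 := by
  refine ⟨defectIsometry hX hXu hT hXT, fun h => ?_, fun i d e hde => ?_, fun d => ?_, ?_⟩
  · exact defectIsometry_graph hX hXu hT hXT ⟨(E.emb h, X h), [], h, rfl, rfl⟩
  · have hm := mapsTo_defectSpace (E.unitary i) (hT i)
    have he : e = (E.family.op i).restrict hm d := Subtype.ext hde
    rw [he]
    refine (denseRange_intertwinerGraphFst hX hXu T).induction_on
      (p := fun d => defectIsometry hX hXu hT hXT ((E.family.op i).restrict hm d) =
        W.op i (defectIsometry hX hXu hT hXT d)) d ?_ ?_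
    · refine isClosed_eq ?_ ?_
      · exact (LinearIsometry.continuous _).comp (ContinuousLinearMap.continuous _)
      · exact (ContinuousLinearMap.continuous _).comp (LinearIsometry.continuous _)
    · intro p
      rw [defectIsometry_graph]
      obtain ⟨⟨x, y⟩, l, h, h1, h2⟩ := p
      -- The graph is stable under `(U_i, W_i)`, with the same word and `h` replaced by `V_i h`.
      have hq : (E.family.op i x, W.op i y) ∈ intertwinerGraph E W hX := by
        refine ⟨l, V.op i h, ?_, ?_⟩
        · rw [word_op_comm, ← E.extends_op]
          exact congrArg _ h1
        · rw [word_op_comm, hX]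
          exact congrArg _ h2
      refine Eq.trans ?_ (defectIsometry_graph hX hXu hT hXT ⟨_, hq⟩)
      congr 1
      exact Subtype.ext (defectOperator_comm (E.unitary i) (hT i) x).symm
  · refine (denseRange_intertwinerGraphFst hX hXu T).induction_on
      (p := fun d => defectIsometry hX hXu hT hXT d ∈ W.unitaryPart) d
      (W.isClosed_unitaryPart.preimage (LinearIsometry.continuous _)) fun p => ?_
    rw [defectIsometry_graph]
    obtain ⟨⟨x, y⟩, l, h, h1, h2⟩ := p
    refine W.mem_unitaryPart_of_word_mem l ?_
    have := hXu h
    rwa [← h2] at this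
  · intro S hS hXS d
    refine (denseRange_intertwinerGraphFst hX hXu T).induction_on
      (p := fun d => ∀ z ∈ S, ⟪defectIsometry hX hXu hT hXT d, z⟫_ℂ = 0) d ?_ fun p z hz => ?_
    · simp only [Set.ofPred_forall]
      refine isClosed_iInter fun z => isClosed_iInter fun _ => isClosed_eq ?_ continuous_const
      exact (LinearIsometry.continuous _).inner continuous_const
    · rw [defectIsometry_graph]
      obtain ⟨⟨x, y⟩, l, h, h1, h2⟩ := p
      change ⟪y, z⟫_ℂ = 0
      -- `⟪W_l^* X h, z⟫ = ⟪X h, W_l z⟫`, and `W_l z` stays in `S`.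
      rw [← inner_map_map_of_norm (W.norm_word l)]
      have hl : ∀ l : List ι, W.word l z ∈ S := by
        intro l
        induction l with
        | nil => exact hz
        | cons k l ih =>
          rw [word_cons]
          exact hS k _ ih
      exact (congrArg (⟪·, W.word l z⟫_ℂ) h2).trans (hXS h _ (hl l))

end DefectIsometry

/-! ### Wandering subspaces and orthogonal sums of isometries -/

section Shift

variable {D : Type w} [NormedAddCommGroup D] [InnerProductSpace ℂ D]
  {K : Type v} [NormedAddCommGroup K] [InnerProductSpace ℂ K]

/-- The isometry `d ↦ S^j Φ d`. -/
def powIsometry (S : K →L[ℂ] K) (hS : ∀ x, ‖S x‖ = ‖x‖) (Φ : D →ₗᵢ[ℂ] K) : ℕ → D →ₗᵢ[ℂ] K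
  | 0 => Φ
  | j + 1 => (⟨S.toLinearMap, hS⟩ : K →ₗᵢ[ℂ] K).comp (powIsometry S hS Φ j)

theorem powIsometry_zero (S : K →L[ℂ] K) (hS : ∀ x, ‖S x‖ = ‖x‖) (Φ : D →ₗᵢ[ℂ] K) :
    powIsometry S hS Φ 0 = Φ := rfl

theorem powIsometry_succ (S : K →L[ℂ] K) (hS : ∀ x, ‖S x‖ = ‖x‖) (Φ : D →ₗᵢ[ℂ] K) (j : ℕ)
    (d : D) : powIsometry S hS Φ (j + 1) d = S (powIsometry S hS Φ j d) := rfl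

theorem powIsometry_mem {S : K →L[ℂ] K} (hS : ∀ x, ‖S x‖ = ‖x‖) {Φ : D →ₗᵢ[ℂ] K}
    {N : Submodule ℂ K} (hN : Set.MapsTo S N N) (hΦ : ∀ d, Φ d ∈ N) (j : ℕ) (d : D) :
    powIsometry S hS Φ j d ∈ N := by
  induction j with
  | zero => exact hΦ d
  | succ j ih => exact hN ih

/-- The wandering subspace argument: common powers of `S` cancel by isometry, leaving `Φ d` against
a vector of `S N`. -/
theorem orthogonalFamily_powIsometry {S : K →L[ℂ] K} (hS : ∀ x, ‖S x‖ = ‖x‖) {Φ : D →ₗᵢ[ℂ] K}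
    {N : Submodule ℂ K} (hN : Set.MapsTo S N N) (hΦ : ∀ d, Φ d ∈ N)
    (hSΦ : ∀ d, ∀ z ∈ N, ⟪Φ d, S z⟫_ℂ = 0) :
    OrthogonalFamily ℂ (fun _ : ℕ => D) (powIsometry S hS Φ) := by
  have h : ∀ i k d e, ⟪powIsometry S hS Φ i d, powIsometry S hS Φ (i + k + 1) e⟫_ℂ = 0 := by
    intro i k d e
    induction i with
    | zero => exact hSΦ d _ (powIsometry_mem hS hN hΦ _ e)
    | succ i ih =>
      rw [show i + 1 + k + 1 = (i + k + 1) + 1 by ring, powIsometry_succ, powIsometry_succ,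
        inner_map_map_of_norm hS, ih]
  intro i j hij d e
  rcases lt_or_gt_of_ne hij with hlt | hlt
  · obtain ⟨k, rfl⟩ := Nat.exists_eq_add_of_lt hlt
    exact h i k d e
  · obtain ⟨k, rfl⟩ := Nat.exists_eq_add_of_lt hlt
    exact inner_eq_zero_symm.1 (h j k e d)

variable {H : Type v} [NormedAddCommGroup H] [InnerProductSpace ℂ H]

/-- The isometry `h ⊕ d ↦ J h + L d`, for isometries `J` and `L` with orthogonal ranges. -/
def sumIsometry {G : Type w} [NormedAddCommGroup G] [InnerProductSpace ℂ G] (J : H →ₗᵢ[ℂ] K)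
    (L : G →ₗᵢ[ℂ] K) (hJL : ∀ h d, ⟪J h, L d⟫_ℂ = 0) : WithLp 2 (H × G) →ₗᵢ[ℂ] K where
  toFun x := J x.fst + L x.snd
  map_add' x y := by
    change J (x.fst + y.fst) + L (x.snd + y.snd) = _
    rw [map_add, map_add]; abel
  map_smul' c x := by
    change J (c • x.fst) + L (c • x.snd) = c • _
    rw [map_smul, map_smul, smul_add]
  norm_map' x := by
    change ‖J x.fst + L x.snd‖ = _
    rw [← sq_eq_sq₀ (norm_nonneg _) (norm_nonneg _), WithLp.prod_norm_sq_eq_of_L2, sq, sq, sq,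
      norm_add_sq_eq_norm_sq_add_norm_sq_of_inner_eq_zero _ _ (hJL _ _), J.norm_map, L.norm_map]

theorem sumIsometry_apply {G : Type w} [NormedAddCommGroup G] [InnerProductSpace ℂ G]
    (J : H →ₗᵢ[ℂ] K) (L : G →ₗᵢ[ℂ] K) (hJL : ∀ h d, ⟪J h, L d⟫_ℂ = 0) (x : WithLp 2 (H × G)) :
    sumIsometry J L hJL x = J x.fst + L x.snd := rfl

end Shift

/-! ### Recovering the model from a pure family -/

section Decomposition

variable {n : Ordinal.{u}} {K : Type v} [NormedAddCommGroup K] [InnerProductSpace ℂ K]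
  [CompleteSpace K] {W : NIsometry (n + 1) K}
  {H : Type v} [NormedAddCommGroup H] [InnerProductSpace ℂ H] [CompleteSpace H]
  {V : NIsometry n H} {A : H →L[ℂ] H} {J : H →ₗᵢ[ℂ] K} {X : H →L[ℂ] K}

theorem exists_modelDefect_isometry (hA : ‖A‖ ≤ 1) (hAV : V.InCommutant A)
    (hV : ∀ k h, W.initial.op k (J h) = J (V.op k h))
    (hl : ∀ h, W.last (J h) = J (A h) + X h)
    (hX : ∀ h, X h ∈ W.initial.unitaryPart)
    (hJ : ∀ h, ∀ y ∈ W.initial.unitaryPart, ⟪J h, y⟫_ℂ = 0) :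
    ∃ Φ : V.modelDefectSpace A hAV →ₗᵢ[ℂ] K,
      (∀ h, Φ (V.modelDefectMap A hAV h) = X h) ∧
      (∀ k d, Φ (V.modelRestrict A hAV k d) = W.initial.op k (Φ d)) ∧
      (∀ d, Φ d ∈ W.initial.unitaryPart) ∧
      ∀ d, ∀ z ∈ W.initial.unitaryPart, ⟪Φ d, W.last z⟫_ℂ = 0 := by
  -- Compute the last operator on `J V_k h` in two ways and cancel the `J A` terms.
  have hXV : ∀ k h, X (V.op k h) = W.initial.op k (X h) := by
    intro k h
    have h1 := hl (V.op k h)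
    rw [← hV, W.inCommutant_last.apply, hl, map_add, hV, hAV.apply] at h1
    exact (add_left_cancel h1).symm
  have hXA : ∀ h, ‖X h‖ = ‖defectOperator (V.minimalUnitaryExtension.extend A hAV)
      (V.minimalUnitaryExtension.emb h)‖ := by
    intro h
    have h1 := V.norm_sq_modelDefectMap A hA hAV h
    -- Pythagoras for `J A h + X h`, whose norm is `‖h‖`.
    have h2 := norm_add_sq_eq_norm_sq_add_norm_sq_of_inner_eq_zero _ _ (hJ (A h) _ (hX h))
    rw [← hl, W.norm_last, J.norm_map, J.norm_map] at h2
    rw [← sq_eq_sq₀ (norm_nonneg _) (norm_nonneg _), ← V.coe_modelDefectMap, ← Submodule.coe_norm]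
    linarith
  obtain ⟨Φ, h1, h2, h3, h4⟩ := exists_defect_isometry hXV hX
    (V.minimalUnitaryExtension.extend_inCommutant A hAV) hXA
  refine ⟨Φ, h1, fun k d => h2 k d _ rfl, h3, fun d z hz => ?_⟩
  refine h4 (W.last '' W.initial.unitaryPart) ?_ ?_ d _ ⟨z, hz, rfl⟩
  · rintro k _ ⟨z, hz, rfl⟩
    exact ⟨_, W.initial.op_mem_unitaryPart k hz, W.inCommutant_last.apply k z⟩
  · rintro h _ ⟨z, hz, rfl⟩
    -- Both terms are orthogonal to `W.last z`: for the first, cancel the isometry `W.last` and use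
    -- that `J h` is orthogonal to the unitary part; for the second, `W.last z` is still in the
    -- unitary part.
    have h5 : X h = W.last (J h) - J (A h) := by rw [hl, add_sub_cancel_left]
    rw [h5, inner_sub_left, inner_map_map_of_norm W.norm_last, hJ h z hz,
      hJ _ _ (map_mem_unitaryPart W.inCommutant_last hz), sub_zero]

/-- The range is closed, the operator being isometric, and contains every `D_Ã x`, because `Ṽ_k` is
onto and commutes with `D_Ã`. -/
theorem modelRestrict_surjective (V : NIsometry n H) (A : H →L[ℂ] H) (hAV : V.InCommutant A)
    (k : Set.Iio n) : Function.Surjective (V.modelRestrict A hAV k) := by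
  have hc : IsClosed (Set.range (V.modelRestrict A hAV k)) :=
    (AddMonoidHomClass.isometry_of_norm (V.modelRestrict A hAV k)
      fun d : V.modelDefectSpace A hAV => V.minimalUnitaryExtension.family.norm_op k d.1).isClosedEmbedding.isClosed_range
  intro d
  refine (denseRange_defectOperator_codRestrict _).induction_on
    (p := (· ∈ Set.range (V.modelRestrict A hAV k))) d hc fun x => ?_
  obtain ⟨y, rfl⟩ := (V.minimalUnitaryExtension.unitary k).2 x
  exact ⟨⟨_, defectOperator_mem _ y⟩, Subtype.ext (defectOperator_comm
    (V.minimalUnitaryExtension.unitary k)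
    (V.minimalUnitaryExtension.extend_inCommutant A hAV k) y).symm⟩

/-- By `hJ` the unitary part is the complement of the range of `J`. The map `h ⊕ d_0 ⊕ d_1 ⊕ ⋯ ↦ J h
+ Σ S^j Φ d_j`, with `S` the last operator, is an intertwining isometry; pureness makes it onto. -/
theorem unitarilyEquivalent_model (hA : ‖A‖ ≤ 1) (hAV : V.InCommutant A)
    (hW : W.IsPure {k : Set.Iio (n + 1) | k.1 < n})
    (hV : ∀ k h, W.initial.op k (J h) = J (V.op k h))
    (hl : ∀ h, W.last (J h) = J (A h) + X h)
    (hX : ∀ h, X h ∈ W.initial.unitaryPart)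
    (hJ : ∀ y, y ∈ W.initial.unitaryPart ↔ ∀ h, ⟪J h, y⟫_ℂ = 0) :
    W.UnitarilyEquivalent (V.model A hA hAV) := by
  classical
  obtain ⟨Φ, h1, h2, h3, h4⟩ := exists_modelDefect_isometry hA hAV hV hl hX
    fun h y hy => (hJ y).1 hy h
  have hN : Set.MapsTo W.last W.initial.unitaryPart W.initial.unitaryPart :=
    fun _ => map_mem_unitaryPart W.inCommutant_last
  have hP := powIsometry_mem W.norm_last hN h3
  have hO := orthogonalFamily_powIsometry W.norm_last hN h3 h4
  have hL : ∀ f, hO.linearIsometry f ∈ W.initial.unitaryPart := fun f =>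
    W.initial.isClosed_unitaryPart.mem_of_tendsto (hO.hasSum_linearIsometry f)
      (Filter.Eventually.of_forall fun s => Submodule.sum_mem _ fun i _ => hP i _)
  have hPV : ∀ k j d, powIsometry W.last W.norm_last Φ j (V.modelRestrict A hAV k d) =
      W.initial.op k (powIsometry W.last W.norm_last Φ j d) := by
    intro k j d
    induction j with
    | zero => exact h2 k d
    | succ j ih => rw [powIsometry_succ, powIsometry_succ, ih, W.inCommutant_last.apply]
  set T := sumIsometry J hO.linearIsometry fun h f => (hJ _).1 (hL f) h with hT
  have hTi : ∀ k x, T ((V.model A hA hAV).initial.op k x) = W.initial.op k (T x) := by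
    intro k x
    rw [hT, sumIsometry_apply, sumIsometry_apply, model_initial_fst, map_add, hV]
    congr 1
    have h5 := (hO.hasSum_linearIsometry x.snd).mapL (W.initial.op k)
    refine (hO.hasSum_linearIsometry _).unique ?_
    simpa only [model_initial_snd, hPV] using h5
  have hTl : ∀ x, T ((V.model A hA hAV).last x) = W.last (T x) := by
    intro x
    rw [hT, sumIsometry_apply, sumIsometry_apply, model_last_fst, map_add, hl, add_assoc]
    congr 1
    have h5 := (hO.hasSum_linearIsometry x.snd).mapL W.last
    refine (hO.hasSum_linearIsometry _).unique ?_
    -- The zeroth term of the series is `Φ (D_Ã h) = X h`; removing it leaves the last operator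
    -- applied to the old series.
    rw [← hasSum_nat_add_iff' 1]
    simpa only [Finset.range_one, Finset.sum_singleton, model_last_snd_zero, model_last_snd_succ,
      powIsometry_succ, powIsometry_zero, h1, add_sub_cancel_left] using h5
  have hTr : ∀ y, (∀ x, ⟪T x, y⟫_ℂ = 0) ↔ y ∈ W.initial.unitaryPart ∧
      ∀ j d, ⟪powIsometry W.last W.norm_last Φ j d, y⟫_ℂ = 0 := by
    intro y
    constructor
    · intro h
      refine ⟨(hJ y).2 fun g => ?_, fun j d => ?_⟩
      · have := h (WithLp.toLp 2 (g, 0))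
        rw [hT, sumIsometry_apply] at this
        simpa using this
      · have := h (WithLp.toLp 2 (0, lp.single 2 j d))
        rw [hT, sumIsometry_apply] at this
        simpa using this
    · rintro ⟨hy, hj⟩ x
      rw [hT, sumIsometry_apply, inner_add_left, (hJ y).1 hy, zero_add]
      have h5 := (hO.hasSum_linearIsometry x.snd).mapL (innerSL ℂ y)
      have h6 : ∀ j, innerSL ℂ y (powIsometry W.last W.norm_last Φ j (x.snd j)) = 0 := fun j =>
        inner_eq_zero_symm.1 (hj j _)
      simp only [h6] at h5
      exact inner_eq_zero_symm.1 (h5.unique hasSum_zero)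
  set R := LinearMap.range T.toLinearMap with hR
  have hRc : CompleteSpace R :=
    T.isometry.isClosedEmbedding.isClosed_range.completeSpace_coe (s := (R : Set K))
  have hRM : ∀ y, y ∈ Rᗮ ↔ y ∈ W.initial.unitaryPart ∧
      ∀ j d, ⟪powIsometry W.last W.norm_last Φ j d, y⟫_ℂ = 0 := by
    intro y
    rw [← hTr, Submodule.mem_orthogonal]
    exact Set.forall_mem_range
  have hRi : W.IsInvariant R := by
    refine (W.isInvariant_iff R).2 ⟨?_, ?_⟩
    · rintro k _ ⟨x, rfl⟩
      exact ⟨_, hTi k x⟩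
    · rintro _ ⟨x, rfl⟩
      exact ⟨_, hTl x⟩
  -- Each `W_k` maps `S^j Φ D` onto itself; onto is what makes the complement of these spaces
  -- invariant under `W_k`.
  have hPU : ∀ k j d, ∃ e, powIsometry W.last W.norm_last Φ j d =
      W.initial.op k (powIsometry W.last W.norm_last Φ j e) := by
    intro k j d
    obtain ⟨e, rfl⟩ := V.modelRestrict_surjective A hAV k d
    exact ⟨e, hPV k j e⟩
  have hMi : W.IsInvariant Rᗮ := by
    refine (W.isInvariant_iff _).2 ⟨fun k y hy => ?_, fun y hy => ?_⟩
    · obtain ⟨hy, hyj⟩ := (hRM y).1 hy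
      refine (hRM _).2 ⟨W.initial.op_mem_unitaryPart k hy, fun j d => ?_⟩
      obtain ⟨e, he⟩ := hPU k j d
      rw [he, inner_map_map_of_norm (W.initial.norm_op k), hyj]
    · obtain ⟨hy, hyj⟩ := (hRM y).1 hy
      refine (hRM _).2 ⟨hN hy, fun j d => ?_⟩
      cases j with
      -- In index zero nothing cancels: here the range of `Φ` being orthogonal to the image of the
      -- unitary part is used.
      | zero => exact h4 d y hy
      | succ j => rw [powIsometry_succ, inner_map_map_of_norm W.norm_last, hyj]
  have hMr : W.IsReducing Rᗮ :=
    ⟨R.isClosed_orthogonal, hMi, by rwa [R.orthogonal_orthogonal]⟩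
  have hM : Rᗮ = ⊥ := by
    refine W.isPure_initial_iff.1 hW _ hMr fun k y hy => ?_
    -- A preimage exists in the unitary part; it lies in `Rᗮ` because the complement of `Rᗮ` is
    -- invariant.
    obtain ⟨z, -, rfl⟩ := W.initial.exists_mem_unitaryPart [k] ((hRM y).1 hy).1
    exact ⟨z, mem_of_isometry_mem (W.initial.norm_op k) (hMr.invariant_orthogonal _) hy, rfl⟩
  have hs : Function.Surjective T :=
    LinearMap.range_eq_top.1 (Submodule.orthogonal_eq_bot_iff.1 hM)
  let Ψ := LinearIsometryEquiv.ofSurjective T hs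
  have hΨ : ∀ k x, Ψ ((V.model A hA hAV).op k x) = W.op k (Ψ x) :=
    forall_index_iff.2 ⟨hTi, hTl⟩
  refine ⟨Ψ.symm, fun k x => ?_⟩
  rw [LinearIsometryEquiv.symm_apply_eq, hΨ, LinearIsometryEquiv.apply_symm_apply]

instance (W : NIsometry n K) : CompleteSpace W.unitaryPart :=
  W.isClosed_unitaryPart.completeSpace_coe

/-- The restriction of a family of commuting isometries to the complement of its unitary part. -/
def nonunitaryPart (W : NIsometry n K) : NIsometry n (W.unitaryPartᗮ : Submodule ℂ K) :=
  W.restrict _ W.isReducing_unitaryPart.invariant_orthogonal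

/-- A vector in the range of all words of the restriction is in the range of all words of `W`, so it
lies in the unitary part and in its complement. -/
theorem nonunitaryPart_isCompletelyNonunitary (W : NIsometry n K) :
    W.nonunitaryPart.IsCompletelyNonunitary := by
  rw [isCompletelyNonunitary_iff, eq_bot_iff]
  intro x hx
  have h1 : ∀ l y, ((W.nonunitaryPart.word l y : (W.unitaryPartᗮ : Submodule ℂ K)) : K) =
      W.word l y := by
    intro l y
    induction l with
    | nil => rfl
    | cons k l ih =>
      rw [word_cons, word_cons, ← ih]
      rfl
  have h2 : (x : K) ∈ W.unitaryPart := by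
    refine mem_unitaryPart.2 fun l => ?_
    obtain ⟨y, rfl⟩ := mem_unitaryPart.1 hx l
    exact ⟨y, (h1 l y).symm⟩
  exact Subtype.ext (inner_self_eq_zero.1 (Submodule.inner_right_of_mem_orthogonal h2 x.2))

/-- `A` is the compression of the last operator to the complement `Nᗮ` of the unitary part, and `X`
is its component from `Nᗮ` into `N`. -/
theorem exists_model (hW : W.IsPure {k : Set.Iio (n + 1) | k.1 < n}) :
    ∃ (V : NIsometry n (W.initial.unitaryPartᗮ : Submodule ℂ K))
      (A : (W.initial.unitaryPartᗮ : Submodule ℂ K) →L[ℂ] (W.initial.unitaryPartᗮ : Submodule ℂ K))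
      (hA : ‖A‖ ≤ 1) (hAV : V.InCommutant A),
      V.IsCompletelyNonunitary ∧ W.UnitarilyEquivalent (V.model A hA hAV) := by
  set N := W.initial.unitaryPart with hN
  let A : (Nᗮ : Submodule ℂ K) →L[ℂ] (Nᗮ : Submodule ℂ K) :=
    Nᗮ.orthogonalProjectionOnto ∘L W.last ∘L Nᗮ.subtypeL
  let X : (Nᗮ : Submodule ℂ K) →L[ℂ] K := N.starProjection ∘L W.last ∘L Nᗮ.subtypeL
  have hl : ∀ h : (Nᗮ : Submodule ℂ K), W.last h = A h + X h := fun h =>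
    ((add_comm _ _).trans (N.starProjection_add_starProjection_orthogonal (W.last h))).symm
  have hX : ∀ h, X h ∈ N := fun h => N.starProjection_apply_mem _
  have hA : ‖A‖ ≤ 1 := by
    refine A.opNorm_le_bound zero_le_one fun h => ?_
    rw [one_mul]
    refine (Nᗮ.norm_orthogonalProjectionOnto_apply_le (W.last h)).trans ?_
    rw [W.norm_last, Submodule.coe_norm]
  have hAV : W.initial.nonunitaryPart.InCommutant A := by
    refine fun k => ContinuousLinearMap.ext fun h => ?_
    let h' : (Nᗮ : Submodule ℂ K) := W.initial.nonunitaryPart.op k h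
    let g : (Nᗮ : Submodule ℂ K) := W.initial.nonunitaryPart.op k (A h)
    change A h' = g
    have h1 : W.last h' = g + W.initial.op k (X h) := by
      change W.last (W.initial.op k h) = W.initial.op k (A h) + _
      rw [W.inCommutant_last.apply, hl, map_add]
    -- The commutator of `A` with `V_k`, applied to `h`, lies in `Nᗮ`; by this identity it also lies
    -- in `N`, so it vanishes.
    have h2 : (A h' - g : K) = W.initial.op k (X h) - X h' := by
      rw [hl] at h1
      rw [sub_eq_sub_iff_add_eq_add, h1, add_comm]
    have h3 : (A h' - g : K) ∈ N := by
      rw [h2]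
      exact N.sub_mem (W.initial.op_mem_unitaryPart k (hX h)) (hX h')
    refine Subtype.ext (sub_eq_zero.1 (inner_self_eq_zero (𝕜 := ℂ).1 ?_))
    exact Submodule.inner_right_of_mem_orthogonal h3 (A h' - g).2
  refine ⟨W.initial.nonunitaryPart, A, hA, hAV, W.initial.nonunitaryPart_isCompletelyNonunitary, ?_⟩
  refine unitarilyEquivalent_model (J := Nᗮ.subtypeₗᵢ) (X := X) hA hAV hW (fun k h => rfl) hl hX
    fun y => ?_
  conv_lhs => rw [← hN, ← N.orthogonal_orthogonal, Submodule.mem_orthogonal]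
  exact ⟨fun h g => h g g.2, fun h g hg => h ⟨g, hg⟩⟩

end Decomposition

end CommutingIsometries

end

theorem theorem3p1 {K : Type v} [NormedAddCommGroup K] [InnerProductSpace ℂ K] [CompleteSpace K]
    (n : Ordinal.{u}) (hn : 1 ≤ n) (W : NIsometry (n + 1) K) :
    W.IsPure {k : Set.Iio (n + 1) | k.1 < n} ↔
      ∃ (H : Type v) (_ : NormedAddCommGroup H) (_ : InnerProductSpace ℂ H) (_ : CompleteSpace H)
        (V : NIsometry n H) (A : H →L[ℂ] H) (hA : ‖A‖ ≤ 1) (hAV : V.InCommutant A),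
        V.IsCompletelyNonunitary ∧ W.UnitarilyEquivalent (V.model A hA hAV) := by
  constructor
  · intro hW
    obtain ⟨V, A, hA, hAV, hV, hWA⟩ := CommutingIsometries.exists_model hW
    exact ⟨_, _, _, inferInstance, V, A, hA, hAV, hV, hWA⟩
  · rintro ⟨H, _, _, _, V, A, hA, hAV, hV, hWA⟩
    exact V.isPure_of_unitarilyEquivalent_model A hA hAV hV hWA
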